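/- All commutative differential graded algebras (CDGAs) are over $\mathbb{Q}$, $\mathbb{Z}$-graded (in particular nonnegatively graded ones are allowed), unital, graded commutative, with a differential of degree $+1$; $\otimes$ is the tensor product over $\mathbb{Q}$ with the usual sign conventions. A relative Sullivan algebra with base $(A,d)$ is an inclusion $i\colon (A,d)\to (A\otimes\Lambda V,D)$, $a\mapsto a\otimes 1$, of CDGAs, where $\Lambda V$ is the free graded commutative algebra on a graded vector space $V$ which is an increasing union of graded subspaces $V(0)\subset V(1)\subset\cdots$ with $D(V(0))\subset A$ and $D(V(k))\subset A\otimes\Lambda V(k-1)$ for $k\ge 1$. It is a relative Sullivan model of a CDGA morphism $\psi\colon (A,d)\to (C,d)$ if $\psi=q\circ i$ for some quasi-isomorphism of CDGAs $q\colon (A\otimes\Lambda V,D)\to (C,d)$. One says that $\psi$ admits a homotopy retraction of CDGAs (resp. of $(A,d)$-modules) if, for some relative Sullivan model $i\colon (A,d)\to(A\otimes\Lambda V,D)$ of $\psi$, there is a morphism of CDGAs (resp. of $(A,d)$-modules, of degree $0$) $r\colon (A\otimes\Lambda V,D)\to (A,d)$ with $r\circ i=\mathrm{id}_A$. For a surjective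 CDGA morphism $\varphi\colon (A,d)\to (B,d)$ and an integer $m\ge 0$ let $$\rho_m\colon (A,d)\to \left(\frac{A}{(\ker\varphi)^{m+1}},\overline{d}\right)$$ be the projection, and let $\mathrm{asecat}(\varphi)$ (resp. $\mathrm{amsecat}(\varphi)$, resp. $\mathrm{ahsecat}(\varphi)$) be the smallest $m\ge 0$ such that $\rho_m$ admits a homotopy retraction of CDGAs (resp. admits a homotopy retraction of $(A,d)$-modules, resp. is injective in cohomology), and $\infty$ if there is no such $m$. **Proposition.** Let $\varphi_i\colon (A_i,d)\to (B_i,d)$, $i=1,2$, be surjective CDGA morphisms. Then 1. $\mathrm{asecat}(\varphi_1\otimes\varphi_2)\le \mathrm{asecat}(\varphi_1)+\mathrm{asecat}(\varphi_2)$; 2. $\mathrm{amsecat}(\varphi_1\otimes\varphi_2)\le \mathrm{amsecat}(\varphi_1)+\mathrm{amsecat}(\varphi_2)$; 3. $\mathrm{ahsecat}(\varphi_1\otimes\varphi_2)\le \mathrm{ahsecat}(\varphi_1)+\mathrm{ahsecat}(\varphi_2)$. -/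

import Mathlib

open scoped TensorProduct DirectSum

universe u

/-- A commutative differential graded algebra over `ℚ`, graded over `ℤ`, with a differential of
degree `+1`.  A nonnegatively graded one is one with `gr i = ⊥` for all `i < 0`. -/
structure CDGA where
  carrier : Type u
  [ring : Ring carrier]
  [algebra : Algebra ℚ carrier]
  gr : ℤ → Submodule ℚ carrier
  [graded : GradedAlgebra gr]
  d : carrier →ₗ[ℚ] carrier
  mul_comm' : ∀ {i j : ℤ} {a b : carrier}, a ∈ gr i → b ∈ gr j →
    a * b = (i * j).negOnePow • (b * a)
  d_mem : ∀ {i : ℤ} {a : carrier}, a ∈ gr i → d a ∈ gr (i + 1)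
  d_d : ∀ a : carrier, d (d a) = 0
  leibniz : ∀ {i : ℤ} {a : carrier} (b : carrier), a ∈ gr i →
    d (a * b) = d a * b + i.negOnePow • (a * d b)

namespace CDGA

instance : CoeSort CDGA.{u} (Type u) := ⟨CDGA.carrier⟩

attribute [instance] CDGA.ring CDGA.algebra CDGA.graded

/-- A morphism of CDGAs: a degree-preserving morphism of unital algebras that commutes with the
differentials. -/
structure Hom (A B : CDGA.{u}) where
  toAlgHom : A →ₐ[ℚ] B
  map_gr : ∀ {i : ℤ} {a : A}, a ∈ A.gr i → toAlgHom a ∈ B.gr i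
  map_d : ∀ a : A, toAlgHom (A.d a) = B.d (toAlgHom a)

instance (A B : CDGA.{u}) : CoeFun (Hom A B) (fun _ => A → B) := ⟨fun f => f.toAlgHom⟩

/-! ### Cohomology -/

/-- The cocycles of a CDGA. -/
def cocycles (A : CDGA.{u}) : Submodule ℚ A := LinearMap.ker A.d

/-- The coboundaries of a CDGA, as a subspace of the cocycles. -/
def coboundaries (A : CDGA.{u}) : Submodule ℚ A.cocycles :=
  (LinearMap.range A.d).comap A.cocycles.subtype

/-- The (total) cohomology of a CDGA. -/
abbrev Cohomology (A : CDGA.{u}) : Type u := A.cocycles ⧸ A.coboundaries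

namespace Hom

variable {A B : CDGA.{u}}

/-- The map induced on cocycles. -/
def cocyclesMap (f : Hom A B) : A.cocycles →ₗ[ℚ] B.cocycles :=
  f.toAlgHom.toLinearMap.restrict (fun a ha => by
    have ha' : A.d a = 0 := ha
    change B.d (f a) = 0
    rw [← f.map_d, ha', map_zero])

/-- The map induced on cohomology. -/
def cohomologyMap (f : Hom A B) : A.Cohomology →ₗ[ℚ] B.Cohomology :=
  Submodule.mapQ A.coboundaries B.coboundaries f.cocyclesMap (by
    rintro ⟨a, ha⟩ ⟨c, hc⟩
    exact ⟨f c, by rw [← f.map_d, hc]; rfl⟩)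

/-- A morphism is homology injective if it is injective on cohomology. -/
def HomologyInjective (f : Hom A B) : Prop := Function.Injective f.cohomologyMap

/-- A quasi-isomorphism. -/
def QuasiIso (f : Hom A B) : Prop := Function.Bijective f.cohomologyMap

end Hom

/-! ### Quotients by differential ideals -/

/-- A differential graded ideal: a two-sided homogeneous ideal stable under the differential. -/
structure IsDGIdeal (A : CDGA.{u}) (I : Ideal A) : Prop where
  twoSided : I.IsTwoSided
  homogeneous : I.IsHomogeneous A.gr
  d_mem : ∀ a ∈ I, A.d a ∈ I

section Quotient

variable (A : CDGA.{u}) (I : Ideal A)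

/-- The grading of a quotient algebra: the images of the homogeneous components. -/
def quotGr [I.IsTwoSided] (i : ℤ) : Submodule ℚ (A ⧸ I) :=
  (A.gr i).map (Ideal.Quotient.mkₐ ℚ I).toLinearMap

variable {A I}

lemma mk_mem_quotGr [I.IsTwoSided] {i : ℤ} {a : A} (ha : a ∈ A.gr i) :
    Ideal.Quotient.mk I a ∈ quotGr A I i :=
  ⟨a, ha, rfl⟩

/-- Componentwise reduction `⨁ Aⁱ → ⨁ (A/I)ⁱ`. -/
noncomputable def quotComp [I.IsTwoSided] : A →+ ⨁ i, quotGr A I i :=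
  (DirectSum.toAddMonoid fun i =>
    (DirectSum.of (fun i => quotGr A I i) i).comp
      { toFun := fun a : A.gr i => ⟨Ideal.Quotient.mk I a, mk_mem_quotGr a.2⟩
        map_zero' := by ext; simp
        map_add' := fun a b => by ext; simp }).comp
    (DirectSum.decomposeAddEquiv A.gr).toAddMonoidHom

lemma quotComp_of_mem [I.IsTwoSided] {i : ℤ} {a : A} (ha : a ∈ A.gr i) :
    quotComp (I := I) a =
      DirectSum.of (fun i => quotGr A I i) i ⟨Ideal.Quotient.mk I a, mk_mem_quotGr ha⟩ := by
  simp [quotComp, DirectSum.decompose_of_mem _ ha]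

lemma quotComp_eq_zero [I.IsTwoSided] (hI : I.IsHomogeneous A.gr) {a : A} (ha : a ∈ I) :
    quotComp (I := I) a = 0 := by
  classical
  rw [← DirectSum.sum_support_decompose A.gr a, map_sum]
  refine Finset.sum_eq_zero fun i _ => ?_
  rw [quotComp_of_mem (SetLike.coe_mem _)]
  have : (⟨Ideal.Quotient.mk I (DirectSum.decompose A.gr a i : A),
      mk_mem_quotGr (SetLike.coe_mem _)⟩ : quotGr A I i) = 0 := by
    ext
    exact Ideal.Quotient.eq_zero_iff_mem.2 (hI i ha)
  rw [this, map_zero]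

/-- The map `A/I → ⨁ (A/I)ⁱ` induced by `quotComp`. -/
noncomputable def quotDecomp [I.IsTwoSided] (hI : I.IsHomogeneous A.gr) :
    A ⧸ I →+ ⨁ i, quotGr A I i :=
  QuotientAddGroup.lift I.toAddSubgroup (quotComp (I := I)) (fun _ ha => quotComp_eq_zero hI ha)

lemma quotDecomp_mk [I.IsTwoSided] (hI : I.IsHomogeneous A.gr) (a : A) :
    quotDecomp hI (Ideal.Quotient.mk I a) = quotComp a := rfl

/-- The additive map induced by the differential on a quotient. -/
def quotD [I.IsTwoSided] (hI : ∀ a ∈ I, A.d a ∈ I) : A ⧸ I →+ A ⧸ I :=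
  QuotientAddGroup.map I.toAddSubgroup I.toAddSubgroup A.d.toAddMonoidHom hI

/-- The quotient of a graded algebra by a homogeneous two-sided ideal is graded. -/
@[reducible]
noncomputable def quotGraded [I.IsTwoSided] (hI : I.IsHomogeneous A.gr) :
    GradedAlgebra (quotGr A I) where
  one_mem := mk_mem_quotGr SetLike.GradedOne.one_mem
  mul_mem := by
    rintro i j _ _ ⟨a, ha, rfl⟩ ⟨b, hb, rfl⟩
    exact ⟨a * b, SetLike.mul_mem_graded ha hb, map_mul (Ideal.Quotient.mk I) a b⟩
  toDecomposition := DirectSum.Decomposition.ofAddHom _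
    (quotDecomp hI)
    (by
      ext x
      obtain ⟨a, rfl⟩ := Ideal.Quotient.mk_surjective x
      change DirectSum.coeAddMonoidHom (quotGr A I) (quotDecomp hI (Ideal.Quotient.mk I a)) =
        Ideal.Quotient.mk I a
      rw [quotDecomp_mk]
      induction a using DirectSum.Decomposition.inductionOn A.gr with
      | zero => simp
      | homogeneous a => simp [quotComp_of_mem a.2]
      | add a b ha hb => rw [map_add, map_add, map_add, ha, hb])
    (by
      ext i ⟨_, a, ha, rfl⟩ : 2
      change quotDecomp hI (DirectSum.coeAddMonoidHom (quotGr A I)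
        (DirectSum.of (fun i => quotGr A I i) i _)) = DirectSum.of (fun i => quotGr A I i) i _
      rw [DirectSum.coeAddMonoidHom_of]
      exact quotComp_of_mem ha)

/-- The quotient CDGA of `A` by a differential graded ideal. -/
noncomputable def quotient (A : CDGA.{u}) (I : Ideal A) (hI : A.IsDGIdeal I) : CDGA.{u} :=
  haveI := hI.twoSided
  { carrier := A ⧸ I
    gr := quotGr A I
    graded := quotGraded hI.homogeneous
    d := (quotD hI.d_mem).toRatLinearMap
    mul_comm' := by
      rintro i j _ _ ⟨a, ha, rfl⟩ ⟨b, hb, rfl⟩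
      change Ideal.Quotient.mkₐ ℚ I a * Ideal.Quotient.mkₐ ℚ I b =
        _ • (Ideal.Quotient.mkₐ ℚ I b * Ideal.Quotient.mkₐ ℚ I a)
      rw [← map_mul, A.mul_comm' ha hb, ← map_mul, Units.smul_def, Units.smul_def, map_zsmul]
    d_mem := by
      rintro i _ ⟨a, ha, rfl⟩
      exact ⟨A.d a, A.d_mem ha, rfl⟩
    d_d := by
      intro x
      obtain ⟨a, rfl⟩ := Ideal.Quotient.mk_surjective x
      change Ideal.Quotient.mk I (A.d (A.d a)) = 0
      rw [A.d_d, map_zero]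
    leibniz := by
      rintro i _ y ⟨a, ha, rfl⟩
      obtain ⟨b, rfl⟩ := Ideal.Quotient.mk_surjective y
      change Ideal.Quotient.mk I (A.d (a * b)) = Ideal.Quotient.mk I (A.d a) *
        Ideal.Quotient.mk I b + _ • (Ideal.Quotient.mk I a * Ideal.Quotient.mk I (A.d b))
      rw [A.leibniz b ha, map_add, map_mul, Units.smul_def, Units.smul_def, map_zsmul, map_mul] }

/-- The projection onto the quotient CDGA. -/
noncomputable def quotientMap (A : CDGA.{u}) (I : Ideal A) (hI : A.IsDGIdeal I) :
    Hom A (A.quotient I hI) :=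
  haveI := hI.twoSided
  { toAlgHom := Ideal.Quotient.mkₐ ℚ I
    map_gr := fun ha => mk_mem_quotGr ha
    map_d := fun _ => rfl }

end Quotient

/-- The kernel of a CDGA morphism, as an ideal. -/
def Hom.ker {A B : CDGA.{u}} (f : Hom A B) : Ideal A := RingHom.ker f.toAlgHom

lemma isDGIdeal_ker {A B : CDGA.{u}} (f : Hom A B) : A.IsDGIdeal f.ker where
  twoSided := inferInstanceAs (RingHom.ker f.toAlgHom).IsTwoSided
  homogeneous := by
    intro i a ha
    have ha0 : f a = 0 := ha
    have key : ∀ x : A, f (DirectSum.decompose A.gr x i : A) = (DirectSum.decompose B.gr (f x) i : B) := by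
      intro x
      induction x using DirectSum.Decomposition.inductionOn A.gr with
      | zero => simp
      | add x y hx hy => simp [DirectSum.decompose_add, hx, hy]
      | @homogeneous j x =>
        by_cases h : j = i
        · subst h
          rw [DirectSum.decompose_of_mem_same _ x.2, DirectSum.decompose_of_mem_same _ (f.map_gr x.2)]
        · rw [DirectSum.decompose_of_mem_ne _ x.2 h, DirectSum.decompose_of_mem_ne _ (f.map_gr x.2) h,
            map_zero]
    change f _ = 0
    rw [key, ha0]; simp
  d_mem := by
    intro a ha
    have ha0 : f a = 0 := ha
    change f _ = 0
    rw [f.map_d, ha0, map_zero]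

lemma IsDGIdeal.mul {A : CDGA.{u}} {I J : Ideal A} (hI : A.IsDGIdeal I) (hJ : A.IsDGIdeal J) :
    A.IsDGIdeal (I * J) where
  twoSided := haveI := hJ.twoSided; inferInstance
  homogeneous := by
    classical
    intro i a ha
    induction ha using Submodule.mul_induction_on' with
    | mem_mul_mem x hx y hy =>
      rw [← DirectSum.sum_support_decompose A.gr x, ← DirectSum.sum_support_decompose A.gr y,
        Finset.sum_mul_sum]
      simp only [DirectSum.decompose_sum, DirectSum.sum_apply, AddSubmonoidClass.coe_finsetSum]
      refine Submodule.sum_mem _ fun p _ => Submodule.sum_mem _ fun q _ => ?_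
      have hm := SetLike.mul_mem_graded (A := A.gr) (SetLike.coe_mem (DirectSum.decompose A.gr x p))
        (SetLike.coe_mem (DirectSum.decompose A.gr y q))
      by_cases h : p + q = i
      · subst h
        rw [DirectSum.decompose_of_mem_same _ hm]
        exact Submodule.mul_mem_mul (hI.homogeneous p hx) (hJ.homogeneous q hy)
      · rw [DirectSum.decompose_of_mem_ne _ hm h]
        exact Submodule.zero_mem _
    | add x _ y _ hx hy =>
      rw [DirectSum.decompose_add, DirectSum.add_apply, Submodule.coe_add]
      exact Submodule.add_mem _ hx hy
  d_mem := by
    classical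
    intro a ha
    induction ha using Submodule.mul_induction_on' with
    | mem_mul_mem x hx y hy =>
      rw [← DirectSum.sum_support_decompose A.gr x, Finset.sum_mul, map_sum]
      refine Submodule.sum_mem _ fun p _ => ?_
      rw [A.leibniz y (SetLike.coe_mem _), Units.smul_def]
      have hp := hI.homogeneous p hx
      exact Submodule.add_mem _ (Submodule.mul_mem_mul (hI.d_mem _ hp) hy)
        (zsmul_mem (Submodule.mul_mem_mul hp (hJ.d_mem _ hy)) _)
    | add x _ y _ hx hy =>
      rw [map_add]
      exact Submodule.add_mem _ hx hy

lemma IsDGIdeal.pow_succ {A : CDGA.{u}} {I : Ideal A} (hI : A.IsDGIdeal I) (m : ℕ) :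
    A.IsDGIdeal (I ^ (m + 1)) := by
  induction m with
  | zero => rw [zero_add, Submodule.pow_one]; exact hI
  | succ m ih => rw [Submodule.pow_succ]; exact ih.mul hI

/-- The quotient `A / (ker φ)^(m+1)` with its induced differential. -/
noncomputable def Hom.kerPowQuotient {A B : CDGA.{u}} (φ : Hom A B) (m : ℕ) : CDGA.{u} :=
  A.quotient (φ.ker ^ (m + 1)) ((isDGIdeal_ker φ).pow_succ m)

/-- The projection `ρ_m : A → A / (ker φ)^(m+1)`. -/
noncomputable def Hom.rho {A B : CDGA.{u}} (φ : Hom A B) (m : ℕ) : Hom A (φ.kerPowQuotient m) :=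
  A.quotientMap (φ.ker ^ (m + 1)) ((isDGIdeal_ker φ).pow_succ m)

/-! ### Tensor products -/

section Tensor

variable (A B : CDGA.{u})

/-- The underlying algebra of the tensor product, with the Koszul sign in the multiplication. -/
def TensorCarrier : Type u := GradedTensorProduct ℚ A.gr B.gr

/-- The graded tensor product multiplication. -/
noncomputable def tensorRing : Ring (TensorCarrier A B) :=
  GradedTensorProduct.instRing A.gr B.gr

noncomputable instance : Ring (TensorCarrier A B) := tensorRing A B

/-- The `ℚ`-algebra structure of the graded tensor product. -/
noncomputable def tensorAlgebra : Algebra ℚ (TensorCarrier A B) :=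
  GradedTensorProduct.instAlgebra A.gr B.gr

noncomputable instance : Algebra ℚ (TensorCarrier A B) := tensorAlgebra A B

/-- The underlying vector space of the tensor product is the usual tensor product. -/
noncomputable def tensorOf : A ⊗[ℚ] B ≃ₗ[ℚ] TensorCarrier A B := GradedTensorProduct.of ℚ A.gr B.gr

variable {A B} in
/-- The pure tensor `a ⊗ b`. -/
noncomputable def tm (a : A) (b : B) : TensorCarrier A B := tensorOf A B (a ⊗ₜ b)

/-- The degree `n` part of `A ⊗ B`: spanned by the `a ⊗ b` with `|a| + |b| = n`. -/
noncomputable def tensorGr (n : ℤ) : Submodule ℚ (TensorCarrier A B) :=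
  Submodule.span ℚ {x | ∃ i j : ℤ, i + j = n ∧ ∃ a ∈ A.gr i, ∃ b ∈ B.gr j, x = tm a b}

variable {A B}

lemma tm_add_left (a a' : A) (b : B) : tm (a + a') b = tm a b + tm a' b :=
  congrArg (tensorOf A B) (TensorProduct.add_tmul a a' b)

lemma tm_add_right (a : A) (b b' : B) : tm a (b + b') = tm a b + tm a b' :=
  congrArg (tensorOf A B) (TensorProduct.tmul_add a b b')

lemma tm_smul_left (c : ℚ) (a : A) (b : B) : tm (c • a) b = c • tm a b := rfl

lemma tm_smul_right (c : ℚ) (a : A) (b : B) : tm a (c • b) = c • tm a b :=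
  congrArg (tensorOf A B) (TensorProduct.tmul_smul c a b)

@[simp]
lemma tm_zero_left (b : B) : tm (0 : A) b = 0 :=
  congrArg (tensorOf A B) (TensorProduct.zero_tmul A b)

@[simp]
lemma tm_zero_right (a : A) : tm a (0 : B) = 0 :=
  congrArg (tensorOf A B) (TensorProduct.tmul_zero B a)

lemma tm_zsmul_left (n : ℤˣ) (a : A) (b : B) : tm (n • a) b = n • tm a b := by
  rcases Int.units_eq_one_or n with rfl | rfl
  · rw [one_smul, one_smul]
  · rw [Units.neg_smul, Units.neg_smul, one_smul, one_smul, eq_neg_iff_add_eq_zero,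
      ← tm_add_left, neg_add_cancel, tm_zero_left]

lemma tm_zsmul_right (n : ℤˣ) (a : A) (b : B) : tm a (n • b) = n • tm a b := by
  rcases Int.units_eq_one_or n with rfl | rfl
  · rw [one_smul, one_smul]
  · rw [Units.neg_smul, Units.neg_smul, one_smul, one_smul, eq_neg_iff_add_eq_zero,
      ← tm_add_right, neg_add_cancel, tm_zero_right]

lemma mul_units_smul {R : Type*} [Ring R] (n : ℤˣ) (x y : R) : x * (n • y) = n • (x * y) := by
  rcases Int.units_eq_one_or n with rfl | rfl <;> simp

lemma units_smul_mul {R : Type*} [Ring R] (n : ℤˣ) (x y : R) : (n • x) * y = n • (x * y) := by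
  rcases Int.units_eq_one_or n with rfl | rfl <;> simp

lemma tm_mem {i j : ℤ} {a : A} {b : B} (ha : a ∈ A.gr i) (hb : b ∈ B.gr j) :
    tm a b ∈ tensorGr A B (i + j) :=
  Submodule.subset_span ⟨i, j, rfl, a, ha, b, hb, rfl⟩

lemma tm_mul_tm {i j : ℤ} (a : A) {b : B} {a' : A} (b' : B) (hb : b ∈ B.gr j) (ha' : a' ∈ A.gr i) :
    tm a b * tm a' b' = (j * i).negOnePow • tm (a * a') (b * b') :=
  GradedTensorProduct.tmul_coe_mul_coe_tmul A.gr B.gr a ⟨b, hb⟩ ⟨a', ha'⟩ b'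

variable (A B) in
/-- The bilinear map `Aⁱ × Bʲ → (A ⊗ B)ⁱ⁺ʲ`. -/
noncomputable def tmBilin (i j : ℤ) : A.gr i →ₗ[ℚ] B.gr j →ₗ[ℚ] tensorGr A B (i + j) :=
  LinearMap.mk₂ ℚ (fun a b => ⟨tm (a : A) (b : B), tm_mem a.2 b.2⟩)
    (fun _ _ _ => Subtype.ext (tm_add_left _ _ _))
    (fun _ _ _ => Subtype.ext (tm_smul_left _ _ _))
    (fun _ _ _ => Subtype.ext (tm_add_right _ _ _))
    (fun _ _ _ => Subtype.ext (tm_smul_right _ _ _))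

variable (A B) in
/-- The decomposition of a tensor into its homogeneous components. -/
noncomputable def tensorDecomp : TensorCarrier A B →ₗ[ℚ] ⨁ n, tensorGr A B n :=
  (TensorProduct.lift
    ((DirectSum.toModule ℚ ℤ (B →ₗ[ℚ] ⨁ n, tensorGr A B n) fun i =>
      LinearMap.flip ((DirectSum.toModule ℚ ℤ (A.gr i →ₗ[ℚ] ⨁ n, tensorGr A B n) fun j =>
        ((tmBilin A B i j).compr₂ (DirectSum.lof ℚ ℤ (fun n => tensorGr A B n) (i + j))).flip) ∘ₗ
          (DirectSum.decomposeLinearEquiv B.gr).toLinearMap)) ∘ₗ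
      (DirectSum.decomposeLinearEquiv A.gr).toLinearMap)) ∘ₗ
    (tensorOf A B).symm.toLinearMap

lemma tensorDecomp_tm {i j n : ℤ} (h : i + j = n) {a : A} {b : B} (ha : a ∈ A.gr i)
    (hb : b ∈ B.gr j) (hab : tm a b ∈ tensorGr A B n) :
    tensorDecomp A B (tm a b) = DirectSum.lof ℚ ℤ (fun n => tensorGr A B n) n ⟨tm a b, hab⟩ := by
  subst h
  simp [tensorDecomp, tm, DirectSum.decomposeLinearEquiv_apply, DirectSum.decompose_of_mem _ ha,
    DirectSum.decompose_of_mem _ hb, tmBilin, ← DirectSum.lof_eq_of ℚ]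

/-- Induction on homogeneous pure tensors. -/
lemma tensor_induction {p : TensorCarrier A B → Prop} (x : TensorCarrier A B)
    (tmul : ∀ (i j : ℤ) (a : A) (b : B), a ∈ A.gr i → b ∈ B.gr j → p (tm a b))
    (add : ∀ x y, p x → p y → p (x + y)) : p x := by
  classical
  have zero : p 0 := by
    simpa using tmul 0 0 0 0 (Submodule.zero_mem _) (Submodule.zero_mem _)
  obtain ⟨t, rfl⟩ := (tensorOf A B).surjective x
  induction t using TensorProduct.induction_on with
  | zero => simpa using zero
  | add s t hs ht => rw [map_add]; exact add _ _ hs ht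
  | tmul a b =>
    induction a using DirectSum.Decomposition.inductionOn A.gr with
    | zero => simpa using zero
    | add a a' h h' => rw [TensorProduct.add_tmul, map_add]; exact add _ _ h h'
    | @homogeneous i a =>
      induction b using DirectSum.Decomposition.inductionOn B.gr with
      | zero => simpa using zero
      | add b b' h h' => rw [TensorProduct.tmul_add, map_add]; exact add _ _ h h'
      | @homogeneous j b => exact tmul i j a b a.2 b.2

/-- Two linear maps on `A ⊗ B` agree if they agree on homogeneous pure tensors. -/
lemma tensor_hom_ext {M : Type*} [AddCommGroup M] [Module ℚ M] {f g : TensorCarrier A B →ₗ[ℚ] M}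
    (h : ∀ (i j : ℤ) (a : A) (b : B), a ∈ A.gr i → b ∈ B.gr j → f (tm a b) = g (tm a b)) :
    f = g :=
  LinearMap.ext fun x => tensor_induction (p := fun x => f x = g x) x h fun x y hx hy => by rw [map_add, map_add, hx, hy]

lemma tensorGr_mul_mem {m n : ℤ} {x y : TensorCarrier A B} (hx : x ∈ tensorGr A B m)
    (hy : y ∈ tensorGr A B n) : x * y ∈ tensorGr A B (m + n) := by
  induction hx using Submodule.span_induction with
  | zero => rw [zero_mul]; exact Submodule.zero_mem _
  | add _ _ _ _ h h' => rw [add_mul]; exact Submodule.add_mem _ h h'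
  | smul c _ _ h => rw [smul_mul_assoc]; exact Submodule.smul_mem _ _ h
  | mem x hx =>
    obtain ⟨i, j, rfl, a, ha, b, hb, rfl⟩ := hx
    induction hy using Submodule.span_induction with
    | zero => rw [mul_zero]; exact Submodule.zero_mem _
    | add _ _ _ _ h h' => rw [mul_add]; exact Submodule.add_mem _ h h'
    | smul c _ _ h => rw [mul_smul_comm]; exact Submodule.smul_mem _ _ h
    | mem y hy =>
      obtain ⟨k, l, rfl, a', ha', b', hb', rfl⟩ := hy
      rw [tm_mul_tm a b' hb ha', Units.smul_def]
      refine zsmul_mem ?_ _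
      have := tm_mem (SetLike.mul_mem_graded ha ha') (SetLike.mul_mem_graded hb hb')
      rwa [add_add_add_comm] at this

/-- The total grading of `A ⊗ B`. -/
noncomputable instance tensorGraded : GradedAlgebra (tensorGr A B) where
  one_mem := by
    have := tm_mem (SetLike.GradedOne.one_mem (A := A.gr)) (SetLike.GradedOne.one_mem (A := B.gr))
    rwa [add_zero] at this
  mul_mem _ _ _ _ hx hy := tensorGr_mul_mem hx hy
  toDecomposition := DirectSum.Decomposition.ofLinearMap _ (tensorDecomp A B)
    (by
      refine tensor_hom_ext fun i j a b ha hb => ?_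
      rw [LinearMap.comp_apply, tensorDecomp_tm rfl ha hb (tm_mem ha hb),
        DirectSum.coeLinearMap_lof]
      rfl)
    (by
      ext n ⟨x, hx⟩ : 2
      rw [LinearMap.comp_apply, LinearMap.comp_apply, DirectSum.coeLinearMap_lof,
        LinearMap.comp_apply, LinearMap.id_apply]
      change tensorDecomp A B x = _
      induction hx using Submodule.span_induction with
      | zero => rw [map_zero]; exact (map_zero _).symm
      | add x y hx hy h h' => rw [map_add, h, h', ← map_add]; rfl
      | smul c x hx h => rw [map_smul, h, ← map_smul]; rfl
      | mem x hx =>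
        obtain ⟨i, j, hij, a, ha, b, hb, rfl⟩ := hx
        exact tensorDecomp_tm hij ha hb _)

/-- The sign involution `a ↦ (-1)^|a| a`. -/
noncomputable def signMap (A : CDGA.{u}) : A →ₗ[ℚ] A :=
  (DirectSum.toModule ℚ ℤ A fun i => ((i.negOnePow : ℤ) : ℚ) • (A.gr i).subtype) ∘ₗ
    (DirectSum.decomposeLinearEquiv A.gr).toLinearMap

lemma signMap_of_mem {i : ℤ} {a : A} (ha : a ∈ A.gr i) :
    A.signMap a = i.negOnePow • a := by
  rw [Units.smul_def, ← Int.cast_smul_eq_zsmul ℚ, signMap, LinearMap.comp_apply,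
    LinearEquiv.coe_coe, DirectSum.decomposeLinearEquiv_apply, DirectSum.decompose_of_mem _ ha,
    ← DirectSum.lof_eq_of ℚ, DirectSum.toModule_lof]
  rfl

variable (A B) in
/-- The differential `d(a ⊗ b) = da ⊗ b + (-1)^|a| a ⊗ db`. -/
noncomputable def tensorD : TensorCarrier A B →ₗ[ℚ] TensorCarrier A B :=
  (tensorOf A B).toLinearMap ∘ₗ
    (TensorProduct.map A.d LinearMap.id + TensorProduct.map A.signMap B.d) ∘ₗ
    (tensorOf A B).symm.toLinearMap

lemma tensorD_tm {i : ℤ} {a : A} (ha : a ∈ A.gr i) (b : B) :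
    tensorD A B (tm a b) = tm (A.d a) b + i.negOnePow • tm a (B.d b) := by
  rw [← tm_zsmul_left, ← signMap_of_mem ha]
  rfl

lemma units_smul_mem {M : Type*} [AddCommGroup M] [Module ℚ M] (S : Submodule ℚ M) (n : ℤˣ) {x : M}
    (hx : x ∈ S) : n • x ∈ S := by
  rw [Units.smul_def]; exact zsmul_mem hx _

lemma map_units_smul {M N : Type*} [AddCommGroup M] [AddCommGroup N] (f : M →+ N) (n : ℤˣ) (x : M) :
    f (n • x) = n • f x := by
  rw [Units.smul_def, Units.smul_def, map_zsmul]

variable (A B) in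
/-- The tensor product of two CDGAs. -/
noncomputable def tensor : CDGA.{u} where
  carrier := TensorCarrier A B
  gr := tensorGr A B
  d := tensorD A B
  mul_comm' := by
    intro m n x y hx hy
    induction hx using Submodule.span_induction with
    | zero => simp
    | add _ _ _ _ h h' => rw [add_mul, mul_add, smul_add, h, h']
    | smul c _ _ h => rw [smul_mul_assoc, mul_smul_comm, h, smul_comm]
    | mem x hx =>
      obtain ⟨i, j, rfl, a, ha, b, hb, rfl⟩ := hx
      induction hy using Submodule.span_induction with
      | zero => simp
      | add _ _ _ _ h h' => rw [mul_add, h, h', ← smul_add, ← add_mul]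
      | smul c _ _ h => rw [smul_mul_assoc, mul_smul_comm, h, smul_comm]
      | mem y hy =>
        obtain ⟨k, l, rfl, a', ha', b', hb', rfl⟩ := hy
        rw [tm_mul_tm a b' hb ha', tm_mul_tm a' b hb' ha, A.mul_comm' ha ha', B.mul_comm' hb hb',
          tm_zsmul_left, tm_zsmul_right, smul_smul, smul_smul, smul_smul,
          ← Int.negOnePow_add, ← Int.negOnePow_add, ← Int.negOnePow_add]
        congr 1
        rw [Int.negOnePow_eq_iff]
        exact ⟨-(i * l) + 0 * j, by ring⟩
  d_mem := by
    intro n x hx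
    induction hx using Submodule.span_induction with
    | zero => rw [map_zero]; exact Submodule.zero_mem _
    | add _ _ _ _ h h' => rw [map_add]; exact Submodule.add_mem _ h h'
    | smul c _ _ h => rw [map_smul]; exact Submodule.smul_mem _ _ h
    | mem x hx =>
      obtain ⟨i, j, rfl, a, ha, b, hb, rfl⟩ := hx
      rw [tensorD_tm ha]
      refine Submodule.add_mem _ ?_ (units_smul_mem _ _ ?_)
      · rw [add_right_comm]; exact tm_mem (A.d_mem ha) hb
      · rw [add_assoc]; exact tm_mem ha (B.d_mem hb)
  d_d := by
    intro x
    induction x using tensor_induction with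
    | add x y hx hy => rw [map_add, map_add, hx, hy, add_zero]
    | tmul i j a b ha hb =>
      have h := map_units_smul (tensorD A B).toAddMonoidHom
      simp only [LinearMap.toAddMonoidHom_coe] at h
      rw [tensorD_tm ha, map_add, h, tensorD_tm (A.d_mem ha), tensorD_tm ha, A.d_d, B.d_d,
        Int.negOnePow_succ]
      simp
  leibniz := by
    intro n x y hx
    induction hx using Submodule.span_induction with
    | zero => simp
    | add x y _ _ h h' => 
      rw [add_mul, map_add, map_add, add_mul, add_mul, smul_add, h, h']; abel
    | smul c _ _ h =>
      rw [smul_mul_assoc, map_smul, map_smul, smul_mul_assoc, smul_mul_assoc, h, smul_add,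
        smul_comm c]
    | mem x hx =>
      obtain ⟨i, j, rfl, a, ha, b, hb, rfl⟩ := hx
      induction y using tensor_induction with
      | add x y hx hy => 
        rw [mul_add, map_add, map_add, mul_add, mul_add, smul_add, hx, hy]; abel
      | tmul k l a' b' ha' hb' =>
        have h := map_units_smul (tensorD A B).toAddMonoidHom
        simp only [LinearMap.toAddMonoidHom_coe] at h
        rw [tm_mul_tm a b' hb ha', h, tensorD_tm (SetLike.mul_mem_graded ha ha'), tensorD_tm ha,
          tensorD_tm ha', A.leibniz a' ha, B.leibniz b' hb]
        simp only [add_mul, mul_add, units_smul_mul, mul_units_smul, tm_add_left, tm_add_right,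
          tm_zsmul_left, tm_zsmul_right, smul_add, smul_smul]
        rw [tm_mul_tm _ _ hb ha', tm_mul_tm _ _ (B.d_mem hb) ha', tm_mul_tm _ _ hb (A.d_mem ha'),
          tm_mul_tm _ _ hb ha']
        simp only [smul_smul, ← Int.negOnePow_add]
        have e1 : (j * k + i).negOnePow = (i + j + j * (k + 1)).negOnePow := by
          rw [Int.negOnePow_eq_iff]; exact ⟨-j, by ring⟩
        have e2 : (j * k + (i + k)).negOnePow = (i + (j + 1) * k).negOnePow := by
          congr 1; ring
        have e3 : (j * k + (i + k + j)).negOnePow = (i + j + k + j * k).negOnePow := by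
          congr 1; ring
        rw [e1, e2, e3]
        exact add_add_add_comm _ _ _ _

end Tensor

/-- The tensor product `φ ⊗ ψ` of two CDGA morphisms. -/
noncomputable def Hom.tensor {A₁ B₁ A₂ B₂ : CDGA.{u}} (φ : Hom A₁ B₁) (ψ : Hom A₂ B₂) :
    Hom (A₁.tensor A₂) (B₁.tensor B₂) := by
  let F : TensorCarrier A₁ A₂ →ₗ[ℚ] TensorCarrier B₁ B₂ :=
    (tensorOf B₁ B₂).toLinearMap ∘ₗ
      TensorProduct.map φ.toAlgHom.toLinearMap ψ.toAlgHom.toLinearMap ∘ₗ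
      (tensorOf A₁ A₂).symm.toLinearMap
  have hF : ∀ (a : A₁) (b : A₂), F (tm a b) = tm (φ a) (ψ b) := fun a b => rfl
  have hs : ∀ (n : ℤˣ) x, F (n • x) = n • F x := map_units_smul F.toAddMonoidHom
  have hmul : ∀ x y, F (x * y) = F x * F y := by
    intro x y
    induction x using tensor_induction with
    | add x x' h h' => rw [add_mul, map_add, map_add, add_mul, h, h']
    | tmul i j a b ha hb =>
      induction y using tensor_induction with
      | add x x' h h' => rw [mul_add, map_add, map_add, mul_add, h, h']
      | tmul k l a' b' ha' hb' =>
        rw [tm_mul_tm _ _ hb ha', hs, hF, hF, hF, tm_mul_tm _ _ (ψ.map_gr hb) (φ.map_gr ha'),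
          map_mul, map_mul]
  exact
  { toAlgHom := AlgHom.ofLinearMap F
      (by
        change F (tm 1 1) = tm 1 1
        rw [hF, map_one, map_one])
      hmul
    map_gr := by
      intro n x hx
      change F x ∈ tensorGr B₁ B₂ n
      refine (Submodule.span_le (p := (tensorGr B₁ B₂ n).comap F)).2 ?_ hx
      rintro _ ⟨i, j, rfl, a, ha, b, hb, rfl⟩
      exact tm_mem (φ.map_gr ha) (ψ.map_gr hb)
    map_d := by
      intro x
      change F (tensorD A₁ A₂ x) = tensorD B₁ B₂ (F x)
      induction x using tensor_induction with
      | add x x' h h' => simp only [map_add, h, h']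
      | tmul i j a b ha hb =>
        rw [tensorD_tm ha, map_add, hs, hF, hF, hF, tensorD_tm (φ.map_gr ha), φ.map_d, ψ.map_d] }

/-! ### Relative Sullivan algebras -/

/-- The relations `x y = (-1)^(|x||y|) y x` between the generators of a free graded commutative
algebra. -/
inductive FreeRel {X : Type u} (deg : X → ℤ) : FreeAlgebra ℚ X → FreeAlgebra ℚ X → Prop
  | swap (x y : X) : FreeRel deg (FreeAlgebra.ι ℚ x * FreeAlgebra.ι ℚ y)
      ((deg x * deg y).negOnePow • (FreeAlgebra.ι ℚ y * FreeAlgebra.ι ℚ x))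

/-- The free graded commutative algebra `ΛV`, where `V` is the graded vector space with basis `X`,
the basis element `x` having degree `deg x`. -/
abbrev Lam {X : Type u} (deg : X → ℤ) : Type u := RingQuot (FreeRel deg)

/-- The algebra morphism `ΛV → S` given by a degree-preserving map on the basis of `V`. -/
noncomputable def lamLift {X : Type u} {deg : X → ℤ} {S : CDGA.{u}} (v : X → S)
    (hv : ∀ x, v x ∈ S.gr (deg x)) : Lam deg →ₐ[ℚ] S :=
  RingQuot.liftAlgHom ℚ ⟨FreeAlgebra.lift ℚ v, by
    rintro _ _ ⟨x, y⟩
    rw [Units.smul_def, map_zsmul, map_mul, map_mul, FreeAlgebra.lift_ι_apply,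
      FreeAlgebra.lift_ι_apply, S.mul_comm' (hv x) (hv y), Units.smul_def]⟩

/-- The map `A ⊗ ΛV → S`, `a ⊗ w ↦ i(a) w`. -/
noncomputable def mulMap {A S : CDGA.{u}} (i : Hom A S) {X : Type u} {deg : X → ℤ} (v : X → S)
    (hv : ∀ x, v x ∈ S.gr (deg x)) : A ⊗[ℚ] Lam deg →ₗ[ℚ] S :=
  TensorProduct.lift
    ((LinearMap.mul ℚ S).compl₁₂ i.toAlgHom.toLinearMap (lamLift v hv).toLinearMap)

/-- `i : A → S` is (the inclusion of the base of) a relative Sullivan algebra: `S = A ⊗ ΛV` as a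
graded algebra, and `V` has a homogeneous basis filtered by `rank` such that the differential of a
basis element lies in the subalgebra generated by `A` and the basis elements of smaller rank, i.e.
with `V(k)` the span of the basis elements of rank at most `k`, one has `V = ⋃ V(k)`,
`d V(0) ⊆ A` and `d V(k) ⊆ A ⊗ ΛV(k-1)`.  As `A` is an arbitrary `ℤ`-graded CDGA, `V` may have
elements in any degree; then every morphism of CDGAs has a relative Sullivan model. -/
def IsRelativeSullivan {A S : CDGA.{u}} (i : Hom A S) : Prop :=
  ∃ (X : Type u) (deg : X → ℤ) (v : X → S) (hv : ∀ x, v x ∈ S.gr (deg x)),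
    Function.Bijective (mulMap i v hv) ∧
    ∃ rank : X → ℕ, ∀ x, S.d (v x) ∈
      Algebra.adjoin ℚ (Set.range i.toAlgHom ∪ v '' {y | rank y < rank x})

/-- `i : A → S` is a relative Sullivan model of `ψ : A → C`: it is a relative Sullivan algebra and
`ψ` factors as `i` followed by a quasi-isomorphism `S → C`. -/
def IsRelativeSullivanModel {A C S : CDGA.{u}} (ψ : Hom A C) (i : Hom A S) : Prop :=
  IsRelativeSullivan i ∧ ∃ q : Hom S C, q.QuasiIso ∧ ∀ a : A, q (i a) = ψ a

/-! ### Homotopy retractions and the three invariants -/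

/-- For `i : A → S`, a morphism of `(A,d)`-modules `S → A`, where `A` acts on `S` through `i`. -/
structure ModuleHom {A S : CDGA.{u}} (i : Hom A S) where
  toLinearMap : S →ₗ[ℚ] A
  map_gr : ∀ {n : ℤ} {s : S}, s ∈ S.gr n → toLinearMap s ∈ A.gr n
  map_d : ∀ s : S, toLinearMap (S.d s) = A.d (toLinearMap s)
  map_act : ∀ (a : A) (s : S), toLinearMap (i a * s) = a * toLinearMap s

/-- `ψ` admits a homotopy retraction of CDGAs. -/
def HasHomotopyRetraction {A C : CDGA.{u}} (ψ : Hom A C) : Prop :=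
  ∃ (S : CDGA.{u}) (i : Hom A S), IsRelativeSullivanModel ψ i ∧
    ∃ r : Hom S A, ∀ a : A, r (i a) = a

/-- `ψ` admits a homotopy retraction of `(A,d)`-modules. -/
def HasModuleHomotopyRetraction {A C : CDGA.{u}} (ψ : Hom A C) : Prop :=
  ∃ (S : CDGA.{u}) (i : Hom A S), IsRelativeSullivanModel ψ i ∧
    ∃ r : ModuleHom i, ∀ a : A, r.toLinearMap (i a) = a

/-- The smallest natural number satisfying `P`, and `∞` if there is none. -/
noncomputable def smallest (P : ℕ → Prop) : ℕ∞ := sInf {N : ℕ∞ | ∃ m : ℕ, P m ∧ N = m}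

variable {A B : CDGA.{u}}

/-- The smallest `m` such that `ρ_m` admits a homotopy retraction of CDGAs. -/
noncomputable def asecat (φ : Hom A B) : ℕ∞ := smallest fun m => HasHomotopyRetraction (φ.rho m)

/-- The smallest `m` such that `ρ_m` admits a homotopy retraction of `(A,d)`-modules. -/
noncomputable def amsecat (φ : Hom A B) : ℕ∞ :=
  smallest fun m => HasModuleHomotopyRetraction (φ.rho m)

/-- The smallest `m` such that `ρ_m` is homology injective. -/
noncomputable def ahsecat (φ : Hom A B) : ℕ∞ := smallest fun m => (φ.rho m).HomologyInjective

end CDGA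

/-! Write `Kᵢ` for the kernel of `φᵢ`. Since both maps are onto, the kernel of `φ₁ ⊗ φ₂` is `K₁ ⊗ A₂
+ A₁ ⊗ K₂`, so its power of exponent `m + n + 1` lies in the sum of the `K₁^i ⊗ K₂^j` with `i + j ≥
m + n + 1`. There `i ≥ m + 1` or `j ≥ n + 1`, so `ρ_m ⊗ ρ_n` kills that power and factors as `π ∘
ρ_{m+n}` (`rho_tensor_rho_eq_zero`, `exists_kerPowQuotient_tensor`). Each inequality then says that
a property of `ρ_m` and `ρ_n` passes to `ρ_{m+n}`.

Injectivity in cohomology: `ρ_m ⊗ ρ_n` is injective in cohomology (`Hom.HomologyInjective.tensor`),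
hence so is its first factor `ρ_{m+n}`. The Künneth theorem is replaced by explicit homotopies: over
a field, a map injective in cohomology has a retraction up to chain homotopy, and such homotopies
can be tensored.

Retractions: let `qᵢ` be the quasi-isomorphisms from the given models `Sᵢ` to the two quotients.
They are onto because the projections are, so `q₁ ⊗ q₂` is a surjective quasi-isomorphism, and so is
its base change along `π`. A relative Sullivan model of the map from `A₁ ⊗ A₂` to the pullback of
`π` and `q₁ ⊗ q₂` is therefore also a model of `ρ_{m+n}`, and it carries a morphism `θ` to `S₁ ⊗ S₂`
under `A₁ ⊗ A₂` (`exists_model_rho_add`). Composing `θ` with `r₁ ⊗ r₂` gives the retraction, for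
algebras and for modules alike. Neither a lifting lemma nor a Sullivan structure on `S₁ ⊗ S₂` is
needed.

The remaining ingredient is the existence of relative Sullivan models
(`exists_relativeSullivanModel`). All generators are adjoined at once: one for every label
consisting of a formal expression for its boundary, an image and a degree. Expressions may involve
generators of smaller nesting depth, and this depth is the Sullivan filtration. -/

namespace CDGA

/-! ### Homogeneous components -/

section Components

variable (A : CDGA.{u})

/-- The homogeneous component of degree `n`. -/
noncomputable def comp (n : ℤ) (a : A) : A := (DirectSum.decompose A.gr a n : A)

variable {A}

lemma comp_mem (n : ℤ) (a : A) : A.comp n a ∈ A.gr n := SetLike.coe_mem _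

lemma comp_of_mem {n : ℤ} {a : A} (ha : a ∈ A.gr n) : A.comp n a = a :=
  DirectSum.decompose_of_mem_same _ ha

lemma comp_of_mem_ne {n m : ℤ} {a : A} (ha : a ∈ A.gr n) (h : n ≠ m) : A.comp m a = 0 :=
  DirectSum.decompose_of_mem_ne _ ha h

@[simp] lemma comp_zero (n : ℤ) : A.comp n 0 = 0 := by simp [comp]

lemma comp_add (n : ℤ) (a b : A) : A.comp n (a + b) = A.comp n a + A.comp n b := by
  simp [comp, DirectSum.decompose_add]

/-- Induction on homogeneous elements. -/
lemma homogeneous_induction {p : A → Prop} (a : A)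
    (hom : ∀ (i : ℤ) (a : A), a ∈ A.gr i → p a) (add : ∀ x y, p x → p y → p (x + y)) : p a := by
  induction a using DirectSum.Decomposition.inductionOn A.gr with
  | zero => exact hom 0 0 (Submodule.zero_mem _)
  | add a a' h h' => exact add _ _ h h'
  | @homogeneous i a => exact hom i a a.2

lemma exists_finset_sum_comp (a : A) : ∃ s : Finset ℤ, ∑ i ∈ s, A.comp i a = a := by
  classical
  exact ⟨_, DirectSum.sum_support_decompose A.gr a⟩

/-- The shift `k` covers morphisms (`k = 0`), differentials (`k = 1`), and derivations not bundled
as the differential of a CDGA. -/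
lemma comp_additive {B : CDGA.{u}} (f : A →+ B) (k : ℤ)
    (hf : ∀ {i : ℤ} {a : A}, a ∈ A.gr i → f a ∈ B.gr (i + k)) (n : ℤ) (a : A) :
    B.comp (n + k) (f a) = f (A.comp n a) := by
  induction a using homogeneous_induction with
  | add x y hx hy => rw [map_add, comp_add, comp_add, map_add, hx, hy]
  | hom i a ha =>
    by_cases h : i = n
    · subst h
      rw [comp_of_mem ha, comp_of_mem (hf ha)]
    · rw [comp_of_mem_ne ha h, comp_of_mem_ne (hf ha) (by simpa using h), map_zero]

lemma comp_d (n : ℤ) (a : A) : A.comp (n + 1) (A.d a) = A.d (A.comp n a) :=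
  comp_additive A.d.toAddMonoidHom 1 A.d_mem n a

lemma Hom.comp_map {B : CDGA.{u}} (f : Hom A B) (n : ℤ) (a : A) :
    B.comp n (f a) = f (A.comp n a) := by
  have := comp_additive (f.toAlgHom.toLinearMap.toAddMonoidHom) 0
    (fun h => by rw [add_zero]; exact f.map_gr h) n a
  rwa [add_zero] at this

lemma Hom.map_units_smul' {B : CDGA.{u}} (f : Hom A B) (n : ℤˣ) (a : A) : f (n • a) = n • f a :=
  map_units_smul f.toAlgHom.toLinearMap.toAddMonoidHom n a

end Components

/-! ### The sign involution -/

section Sign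

variable {A B : CDGA.{u}}

lemma signMap_mem {i : ℤ} {a : A} (ha : a ∈ A.gr i) : A.signMap a ∈ A.gr i := by
  rw [signMap_of_mem ha]; exact units_smul_mem _ _ ha

lemma signMap_one : A.signMap 1 = 1 := by
  rw [signMap_of_mem SetLike.GradedOne.one_mem, Int.negOnePow_zero, one_smul]

lemma signMap_mul (a b : A) : A.signMap (a * b) = A.signMap a * A.signMap b := by
  induction a using homogeneous_induction with
  | add x y hx hy => simp only [add_mul, map_add, hx, hy]
  | hom i a ha =>
    induction b using homogeneous_induction with
    | add x y hx hy => simp only [mul_add, map_add, hx, hy]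
    | hom j b hb =>
      rw [signMap_of_mem ha, signMap_of_mem hb, signMap_of_mem (SetLike.mul_mem_graded ha hb),
        mul_units_smul, units_smul_mul, smul_smul, Int.negOnePow_add, mul_comm]

lemma signMap_signMap (a : A) : A.signMap (A.signMap a) = a := by
  induction a using homogeneous_induction with
  | add x y hx hy => simp only [map_add, hx, hy]
  | hom i a ha =>
    rw [signMap_of_mem (signMap_mem ha), signMap_of_mem ha, smul_smul, Int.units_mul_self,
      one_smul]

/-- Only the degree of `f` matters, so this applies to a derivation before its square is known to
vanish. -/
lemma signMap_odd {f : A →ₗ[ℚ] B} (hf : ∀ {i : ℤ} {a : A}, a ∈ A.gr i → f a ∈ B.gr (i + 1))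
    (a : A) : B.signMap (f a) = - f (A.signMap a) := by
  induction a using homogeneous_induction with
  | add x y hx hy => simp only [map_add, hx, hy]; abel
  | hom i a ha =>
    have := map_units_smul f.toAddMonoidHom i.negOnePow a
    simp only [LinearMap.toAddMonoidHom_coe] at this
    rw [signMap_of_mem ha, signMap_of_mem (hf ha), this, Int.negOnePow_succ, Units.neg_smul]

lemma signMap_d (a : A) : A.signMap (A.d a) = - A.d (A.signMap a) := signMap_odd A.d_mem a

lemma Hom.signMap_map (f : Hom A B) (a : A) : B.signMap (f a) = f (A.signMap a) := by
  induction a using homogeneous_induction with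
  | add x y hx hy => simp only [map_add, hx, hy]
  | hom i a ha => rw [signMap_of_mem ha, signMap_of_mem (f.map_gr ha), f.map_units_smul']

/-- With the involution in place of the power of `-1`, the rule needs no homogeneity and suits
inductions over sums and products. -/
lemma leibniz_signMap (a b : A) : A.d (a * b) = A.d a * b + A.signMap a * A.d b := by
  induction a using homogeneous_induction with
  | add x y hx hy => simp only [map_add, hx, hy, add_mul]; abel
  | hom i a ha => rw [signMap_of_mem ha, A.leibniz b ha, units_smul_mul]

lemma d_one : A.d 1 = 0 := by
  have := leibniz_signMap (1 : A) 1
  rw [signMap_one, mul_one, one_mul, mul_one] at this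
  exact left_eq_add.1 this

end Sign

/-! ### The free graded commutative algebra as a CDGA with zero differential -/

section Lam

variable {X : Type u} {deg : X → ℤ}

/-- The free graded commutative algebra `ΛV`. -/
def FreeGC (deg : X → ℤ) : Type u := Lam deg

noncomputable instance : Ring (FreeGC deg) := inferInstanceAs (Ring (Lam deg))

noncomputable instance : Algebra ℚ (FreeGC deg) := inferInstanceAs (Algebra ℚ (Lam deg))

/-- The identification of the two descriptions of `ΛV`. -/
noncomputable def freeGCEquiv (deg : X → ℤ) : Lam deg ≃ₐ[ℚ] FreeGC deg :=
  AlgEquiv.refl (R := ℚ) (A₁ := Lam deg)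

/-- The generator of `ΛV` given by a basis element of `V`. -/
noncomputable def lamι (deg : X → ℤ) (x : X) : FreeGC deg :=
  freeGCEquiv deg (RingQuot.mkAlgHom ℚ (FreeRel deg) (FreeAlgebra.ι ℚ x))

lemma lamι_mul_lamι (x y : X) :
    lamι deg x * lamι deg y = (deg x * deg y).negOnePow • (lamι deg y * lamι deg x) := by
  have := congrArg (freeGCEquiv deg) (RingQuot.mkAlgHom_rel ℚ (FreeRel.swap (deg := deg) x y))
  rwa [map_mul, map_mul, Units.smul_def, map_zsmul, map_zsmul, map_mul, map_mul,
    ← Units.smul_def] at this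

/-- The algebra morphism out of `ΛV` given by the values on a basis of `V`. -/
noncomputable def lamHom {T : Type*} [Ring T] [Algebra ℚ T] (v : X → T)
    (hv : ∀ x y, v x * v y = (deg x * deg y).negOnePow • (v y * v x)) : FreeGC deg →ₐ[ℚ] T :=
  (RingQuot.liftAlgHom ℚ ⟨FreeAlgebra.lift ℚ v, by
    rintro _ _ ⟨x, y⟩
    rw [Units.smul_def, map_zsmul, map_mul, map_mul, FreeAlgebra.lift_ι_apply,
      FreeAlgebra.lift_ι_apply, hv, Units.smul_def]⟩).comp (freeGCEquiv deg).symm.toAlgHom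

@[simp] lemma lamHom_lamι {T : Type*} [Ring T] [Algebra ℚ T] (v : X → T)
    (hv : ∀ x y, v x * v y = (deg x * deg y).negOnePow • (v y * v x)) (x : X) :
    lamHom v hv (lamι deg x) = v x := by
  rw [lamHom, lamι]
  change RingQuot.liftAlgHom ℚ _ (RingQuot.mkAlgHom ℚ (FreeRel deg) (FreeAlgebra.ι ℚ x)) = _
  rw [RingQuot.liftAlgHom_mkAlgHom_apply, FreeAlgebra.lift_ι_apply]

lemma lamLift_lamι {S : CDGA.{u}} (v : X → S) (hv : ∀ x, v x ∈ S.gr (deg x)) (x : X) :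
    lamLift v hv ((freeGCEquiv deg).symm (lamι deg x)) = v x := by
  rw [lamLift, lamι, AlgEquiv.symm_apply_apply, RingQuot.liftAlgHom_mkAlgHom_apply, FreeAlgebra.lift_ι_apply]

lemma lam_induction {p : FreeGC deg → Prop} (w : FreeGC deg)
    (algebraMap : ∀ r : ℚ, p (algebraMap ℚ (FreeGC deg) r)) (ι : ∀ x, p (lamι deg x))
    (mul : ∀ x y, p x → p y → p (x * y)) (add : ∀ x y, p x → p y → p (x + y)) : p w := by
  obtain ⟨w, rfl⟩ := (freeGCEquiv deg).surjective w
  obtain ⟨w, rfl⟩ := RingQuot.mkAlgHom_surjective ℚ (FreeRel deg) w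
  induction w using FreeAlgebra.induction with
  | grade0 r => rw [AlgHom.commutes, AlgEquiv.commutes]; exact algebraMap r
  | grade1 x => exact ι x
  | mul a b ha hb => rw [map_mul, map_mul]; exact mul _ _ ha hb
  | add a b ha hb => rw [map_add, map_add]; exact add _ _ ha hb

lemma lam_algHom_ext {T : Type*} [Ring T] [Algebra ℚ T] {f g : FreeGC deg →ₐ[ℚ] T}
    (h : ∀ x, f (lamι deg x) = g (lamι deg x)) : f = g := by
  refine AlgHom.ext fun w => ?_
  induction w using lam_induction with
  | algebraMap r => rw [AlgHom.commutes, AlgHom.commutes]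
  | ι x => exact h x
  | mul x y hx hy => rw [map_mul, map_mul, hx, hy]
  | add x y hx hy => rw [map_add, map_add, hx, hy]

/-- The degree `n` part of `ΛV`, spanned by the words of total degree `n`. -/
noncomputable def lamGr (deg : X → ℤ) (n : ℤ) : Submodule ℚ (FreeGC deg) :=
  Submodule.span ℚ {w : FreeGC deg | ∃ l : List X, (l.map deg).sum = n ∧ w = (l.map (lamι deg)).prod}

lemma lamι_mem (x : X) : lamι deg x ∈ lamGr deg (deg x) :=
  Submodule.subset_span ⟨[x], by simp, by simp⟩

instance lamGr_gradedMonoid : SetLike.GradedMonoid (lamGr deg) where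
  one_mem := Submodule.subset_span ⟨([] : List X), by simp, by simp⟩
  mul_mem := by
    intro m n x y hx hy
    induction hx using Submodule.span_induction with
    | zero => rw [zero_mul]; exact Submodule.zero_mem _
    | add _ _ _ _ h h' => rw [add_mul]; exact Submodule.add_mem _ h h'
    | smul c _ _ h => rw [smul_mul_assoc]; exact Submodule.smul_mem _ _ h
    | mem x hx =>
      obtain ⟨l, rfl, rfl⟩ := hx
      induction hy using Submodule.span_induction with
      | zero => rw [mul_zero]; exact Submodule.zero_mem _
      | add _ _ _ _ h h' => rw [mul_add]; exact Submodule.add_mem _ h h'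
      | smul c _ _ h => rw [mul_smul_comm]; exact Submodule.smul_mem _ _ h
      | mem y hy =>
        obtain ⟨l', rfl, rfl⟩ := hy
        exact Submodule.subset_span ⟨l ++ l', by simp, by simp⟩

lemma map_mem_of_map_lamι_mem {T : Type*} [Ring T] [Algebra ℚ T] (G : ℤ → Submodule ℚ T)
    [SetLike.GradedMonoid G] {f : FreeGC deg →ₐ[ℚ] T} (hf : ∀ x, f (lamι deg x) ∈ G (deg x))
    {n : ℤ} {w : FreeGC deg} (hw : w ∈ lamGr deg n) : f w ∈ G n := by
  refine (Submodule.span_le (p := (G n).comap f.toLinearMap)).2 ?_ hw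
  clear hw
  rintro _ ⟨l, rfl, rfl⟩
  change f _ ∈ G _
  induction l with
  | nil => simpa using SetLike.GradedOne.one_mem (A := G)
  | cons x l ih =>
    simp only [List.map_cons, List.prod_cons, List.sum_cons, map_mul] at ih ⊢
    exact SetLike.mul_mem_graded (hf x) ih

/-- Moving a generator past a word one letter at a time, then a word past a word, accumulates the
sign additively in the exponent; bilinearity does the rest. -/
lemma lamGr_comm {m n : ℤ} {x y : FreeGC deg} (hx : x ∈ lamGr deg m) (hy : y ∈ lamGr deg n) :
    x * y = (m * n).negOnePow • (y * x) := by
  have gen : ∀ (x : X) (l : List X), lamι deg x * (l.map (lamι deg)).prod =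
      (deg x * (l.map deg).sum).negOnePow • ((l.map (lamι deg)).prod * lamι deg x) := by
    intro x l
    induction l with
    | nil => simp
    | cons y l ih =>
      simp only [List.map_cons, List.prod_cons, List.sum_cons]
      rw [← mul_assoc, lamι_mul_lamι, units_smul_mul, mul_assoc, ih, mul_units_smul, smul_smul,
        ← Int.negOnePow_add, mul_assoc, mul_add]
  have words : ∀ (l l' : List X), (l.map (lamι deg)).prod * (l'.map (lamι deg)).prod =
      ((l.map deg).sum * (l'.map deg).sum).negOnePow •
        ((l'.map (lamι deg)).prod * (l.map (lamι deg)).prod) := by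
    intro l l'
    induction l with
    | nil => simp
    | cons y l ih =>
      simp only [List.map_cons, List.prod_cons, List.sum_cons]
      rw [mul_assoc, ih, mul_units_smul, ← mul_assoc, gen, units_smul_mul, smul_smul,
        ← Int.negOnePow_add, mul_assoc, add_mul, add_comm]
  induction hx using Submodule.span_induction with
  | zero => simp
  | add _ _ _ _ h h' => rw [add_mul, mul_add, smul_add, h, h']
  | smul c _ _ h => rw [smul_mul_assoc, mul_smul_comm, h, smul_comm]
  | mem x hx =>
    obtain ⟨l, rfl, rfl⟩ := hx
    induction hy using Submodule.span_induction with
    | zero => simp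
    | add _ _ _ _ h h' => rw [mul_add, h, h', ← smul_add, ← add_mul]
    | smul c _ _ h => rw [smul_mul_assoc, mul_smul_comm, h, smul_comm]
    | mem y hy =>
      obtain ⟨l', rfl, rfl⟩ := hy
      exact words l l'

/-- The decomposition of an element of `ΛV` into its homogeneous components. -/
noncomputable def lamDecomp (deg : X → ℤ) : FreeGC deg →ₐ[ℚ] ⨁ n, lamGr deg n :=
  lamHom (deg := deg) (fun x => DirectSum.of (fun n => lamGr deg n) (deg x) ⟨lamι deg x, lamι_mem x⟩) (by
    intro x y
    rw [DirectSum.of_mul_of, DirectSum.of_mul_of]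
    have hs (n : ℤˣ) (z : lamGr deg (deg y + deg x)) :
        n • DirectSum.of (fun n => lamGr deg n) (deg y + deg x) z =
          DirectSum.of (fun n => lamGr deg n) (deg y + deg x) (n • z) := by
      rw [Units.smul_def, Units.smul_def, map_zsmul]
    rw [hs]
    -- The two products sit in the summands of index `deg x + deg y` and `deg y + deg x`, so they
    -- are compared as elements of the graded monoid.
    refine DirectSum.of_eq_of_gradedMonoid_eq (Sigma.subtype_ext (add_comm _ _) ?_)
    rw [Units.smul_def]
    change lamι deg x * lamι deg y = (((deg x * deg y).negOnePow : ℤ) • (lamι deg y * lamι deg x))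
    rw [lamι_mul_lamι, Units.smul_def])

/-- The decomposition is an algebra morphism, so one identity need only be checked on generators,
the other on words. -/
noncomputable instance lamGraded : GradedAlgebra (lamGr deg) :=
  GradedAlgebra.ofAlgHom _ (lamDecomp deg)
    (lam_algHom_ext fun x => by
      rw [AlgHom.comp_apply, lamDecomp, lamHom_lamι, DirectSum.coeAlgHom_of, AlgHom.id_apply])
    (by
      rintro n ⟨w, hw⟩
      induction hw using Submodule.span_induction with
      | zero => rw [map_zero]; exact (map_zero _).symm
      | add x y hx hy h h' => rw [map_add, h, h', ← map_add]; rfl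
      | smul c x hx h =>
        rw [map_smul, h, ← DirectSum.lof_eq_of ℚ, ← map_smul]; rfl
      | mem x hx =>
        obtain ⟨l, rfl, rfl⟩ := hx
        change lamDecomp deg (l.map (lamι deg)).prod = _
        induction l with
        | nil => simp only [List.map_nil, List.prod_nil, map_one]; rfl
        | cons x l ih =>
          simp only [List.map_cons, List.prod_cons, map_mul]
          rw [ih, lamDecomp, lamHom_lamι,
            DirectSum.of_mul_of]
          rfl)

/-- `ΛV` as a CDGA with zero differential. -/
noncomputable def lam (deg : X → ℤ) : CDGA.{u} where
  carrier := FreeGC deg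
  gr := lamGr deg
  d := 0
  mul_comm' := lamGr_comm
  d_mem _ := Submodule.zero_mem _
  d_d _ := rfl
  leibniz _ _ := by simp

end Lam

/-! ### Algebra morphisms out of a tensor product -/

section TensorLift

variable {A B : CDGA.{u}}

/-- The pure tensor `a ⊗ b`, as an element of the CDGA `A ⊗ B`. -/
noncomputable def tmul (a : A) (b : B) : A.tensor B := tm a b

lemma tmul_add_left (a a' : A) (b : B) : tmul (a + a') b = tmul a b + tmul a' b :=
  tm_add_left a a' b

lemma tmul_add_right (a : A) (b b' : B) : tmul a (b + b') = tmul a b + tmul a b' :=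
  tm_add_right a b b'

@[simp] lemma tmul_zero_left (b : B) : tmul (0 : A) b = 0 := tm_zero_left b

@[simp] lemma tmul_zero_right (a : A) : tmul a (0 : B) = 0 := tm_zero_right a

lemma tmul_units_smul_left (n : ℤˣ) (a : A) (b : B) : tmul (n • a) b = n • tmul a b :=
  tm_zsmul_left n a b

lemma tmul_mem {i j : ℤ} {a : A} {b : B} (ha : a ∈ A.gr i) (hb : b ∈ B.gr j) :
    tmul a b ∈ (A.tensor B).gr (i + j) := tm_mem ha hb

lemma tmul_mul_tmul {i j : ℤ} (a : A) {b : B} {a' : A} (b' : B) (hb : b ∈ B.gr j)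
    (ha' : a' ∈ A.gr i) :
    tmul a b * tmul a' b' = (j * i).negOnePow • tmul (a * a') (b * b') :=
  tm_mul_tm a b' hb ha'

lemma tmul_induction {p : A.tensor B → Prop} (x : A.tensor B)
    (tmul : ∀ (a : A) (b : B), p (tmul a b)) (add : ∀ x y, p x → p y → p (x + y)) : p x :=
  tensor_induction x (fun _ _ a b _ _ => tmul a b) add

lemma Hom.tensor_tmul {A' B' : CDGA.{u}} (f : Hom A A') (g : Hom B B') (a : A) (b : B) :
    f.tensor g (tmul a b) = tmul (f a) (g b) := rfl

lemma tmul_one_mul_tmul (a a' : A) (b : B) : tmul a 1 * tmul a' b = tmul (a * a') b := by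
  induction a' using homogeneous_induction with
  | add x y hx hy => rw [tmul_add_left, mul_add, mul_add, tmul_add_left, hx, hy]
  | hom i a' ha' =>
    rw [tmul_mul_tmul a b SetLike.GradedOne.one_mem ha', zero_mul, Int.negOnePow_zero, one_smul,
      one_mul]

lemma tmul_one_mul_one_tmul (a : A) (b : B) : tmul a 1 * tmul 1 b = tmul a b := by
  rw [tmul_one_mul_tmul, mul_one]

lemma d_tmul (a : A) (b : B) :
    (A.tensor B).d (tmul a b) = tmul (A.d a) b + tmul (A.signMap a) (B.d b) := by
  induction a using homogeneous_induction with
  | add x y hx hy =>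
    rw [tmul_add_left, map_add, map_add, map_add, tmul_add_left, tmul_add_left, hx, hy]; abel
  | hom i a ha =>
    rw [signMap_of_mem ha, tmul_units_smul_left]
    exact tensorD_tm ha b

variable (A B) in
/-- The inclusion `a ↦ a ⊗ 1`. -/
noncomputable def inclLeft : Hom A (A.tensor B) where
  toAlgHom := GradedTensorProduct.includeLeft A.gr B.gr
  map_gr := by
    intro i a ha
    have := tmul_mem ha (SetLike.GradedOne.one_mem (A := B.gr))
    rwa [add_zero] at this
  map_d := by
    intro a
    change tmul (A.d a) 1 = (A.tensor B).d (tmul a 1)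
    rw [d_tmul, d_one, tmul_zero_right, add_zero]

variable (A B) in
/-- The algebra morphism `b ↦ 1 ⊗ b`. -/
noncomputable def inclRight : B →ₐ[ℚ] (A.tensor B) :=
  GradedTensorProduct.includeRight A.gr B.gr

lemma tmul_one_mem {i : ℤ} {b : B} (hb : b ∈ B.gr i) : tmul (1 : A) b ∈ (A.tensor B).gr i := by
  have := tmul_mem (SetLike.GradedOne.one_mem (A := A.gr)) hb
  rwa [zero_add] at this

/-- The algebra morphism on a tensor product given by its values on the two factors. -/
noncomputable def tensorLift {T : Type*} [Ring T] [Algebra ℚ T] (f : A →ₐ[ℚ] T) (g : B →ₐ[ℚ] T)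
    (h : ∀ ⦃i j : ℤ⦄ ⦃a : A⦄ ⦃b : B⦄, a ∈ A.gr i → b ∈ B.gr j →
      f a * g b = (j * i).negOnePow • (g b * f a)) : A.tensor B →ₐ[ℚ] T :=
  GradedTensorProduct.lift A.gr B.gr f g fun _ _ a b => h a.2 b.2

lemma tensorLift_tmul {T : Type*} [Ring T] [Algebra ℚ T] (f : A →ₐ[ℚ] T) (g : B →ₐ[ℚ] T)
    (h : ∀ ⦃i j : ℤ⦄ ⦃a : A⦄ ⦃b : B⦄, a ∈ A.gr i → b ∈ B.gr j →
      f a * g b = (j * i).negOnePow • (g b * f a)) (a : A) (b : B) :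
    tensorLift f g h (tmul a b) = f a * g b := rfl

lemma tensorLift_mem {T : Type*} [Ring T] [Algebra ℚ T] (G : ℤ → Submodule ℚ T)
    [SetLike.GradedMonoid G] (f : A →ₐ[ℚ] T) (g : B →ₐ[ℚ] T)
    (h : ∀ ⦃i j : ℤ⦄ ⦃a : A⦄ ⦃b : B⦄, a ∈ A.gr i → b ∈ B.gr j →
      f a * g b = (j * i).negOnePow • (g b * f a))
    (hf : ∀ ⦃i : ℤ⦄ ⦃a : A⦄, a ∈ A.gr i → f a ∈ G i)
    (hg : ∀ ⦃i : ℤ⦄ ⦃b : B⦄, b ∈ B.gr i → g b ∈ G i) {n : ℤ} {x : A.tensor B}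
    (hx : x ∈ (A.tensor B).gr n) : tensorLift f g h x ∈ G n := by
  refine (Submodule.span_le (p := (G n).comap (tensorLift f g h).toLinearMap)).2 ?_ hx
  rintro _ ⟨i, j, rfl, a, ha, b, hb, rfl⟩
  change tensorLift f g h (tmul a b) ∈ G _
  rw [tensorLift_tmul]
  exact SetLike.mul_mem_graded (hf ha) (hg hb)

end TensorLift

/-! ### Derivations as morphisms to triangular matrices -/

section Triangular

variable (F : CDGA.{u})

/-- The matrices `[[(-1)ⁿ x, y], [0, x]]` with `|x| = n` and `|y| = n + 1`. -/
def triGr (n : ℤ) : Submodule ℚ (Matrix (Fin 2) (Fin 2) F) where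
  carrier := {m | m 1 1 ∈ F.gr n ∧ m 0 1 ∈ F.gr (n + 1) ∧ m 1 0 = 0 ∧
    m 0 0 = n.negOnePow • m 1 1}
  zero_mem' := ⟨Submodule.zero_mem _, Submodule.zero_mem _, rfl, by simp⟩
  add_mem' := by
    rintro m m' ⟨h1, h2, h3, h4⟩ ⟨h1', h2', h3', h4'⟩
    exact ⟨Submodule.add_mem _ h1 h1', Submodule.add_mem _ h2 h2', by simp [h3, h3'],
      by simp [h4, h4']⟩
  smul_mem' := by
    rintro c m ⟨h1, h2, h3, h4⟩
    exact ⟨Submodule.smul_mem _ _ h1, Submodule.smul_mem _ _ h2, by simp [h3],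
      by simp [h4, smul_comm c]⟩

variable {F}

instance triGr_gradedMonoid : SetLike.GradedMonoid F.triGr where
  one_mem := ⟨by simpa using SetLike.GradedOne.one_mem, by simp, by simp, by simp⟩
  mul_mem := by
    rintro i j m m' ⟨h1, h2, h3, h4⟩ ⟨h1', h2', h3', h4'⟩
    simp only [triGr, Submodule.mem_mk, AddSubmonoid.mem_mk, AddSubsemigroup.mem_mk,
      Set.mem_ofPred_eq, Matrix.mul_apply, Fin.sum_univ_two, h3, h3', h4, h4', zero_mul, mul_zero,
      zero_add, add_zero, units_smul_mul, mul_units_smul, smul_smul, Int.negOnePow_add, smul_zero,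
      mul_comm j.negOnePow, and_true]
    refine ⟨SetLike.mul_mem_graded h1 h1', Submodule.add_mem _ (units_smul_mem _ _ ?_) ?_⟩
    · rw [add_assoc]; exact SetLike.mul_mem_graded h1 h2'
    · rw [add_right_comm]; exact SetLike.mul_mem_graded h2 h1'

/-- This is why the corner entry has degree one more and the first diagonal entry carries a sign:
the family is graded commutative, so the universal property of `A ⊗ ΛV` applies with these matrices
as target. -/
lemma triGr_comm {i j : ℤ} {m m' : Matrix (Fin 2) (Fin 2) F} (hm : m ∈ F.triGr i)
    (hm' : m' ∈ F.triGr j) : m * m' = (i * j).negOnePow • (m' * m) := by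
  obtain ⟨h1, h2, h3, h4⟩ := hm
  obtain ⟨h1', h2', h3', h4'⟩ := hm'
  have e1 : (i + i * (j + 1)).negOnePow = (i * j).negOnePow := by
    rw [Int.negOnePow_eq_iff]; exact ⟨i, by ring⟩
  have e2 : ((i + 1) * j).negOnePow = (i * j + j).negOnePow := by congr 1; ring
  ext p q
  fin_cases p <;> fin_cases q <;>
    simp only [Fin.zero_eta, Fin.mk_one, Fin.isValue, Matrix.mul_apply, Fin.sum_univ_two,
      Matrix.smul_apply, h3, h3', h4, h4', zero_mul, mul_zero, zero_add, add_zero, units_smul_mul,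
      mul_units_smul, smul_zero]
  · rw [F.mul_comm' h1 h1', smul_smul, smul_smul, smul_smul, smul_smul, mul_comm, mul_assoc,
      mul_comm]
    congr 1
    ac_rfl
  · rw [F.mul_comm' h1 h2', F.mul_comm' h2 h1', smul_add, smul_smul, smul_smul,
      ← Int.negOnePow_add, ← Int.negOnePow_add, e1, e2, add_comm]
  · rw [F.mul_comm' h1 h1']

/-- The matrix `[[s(x), y], [0, x]]`, where `s` is the sign involution. -/
noncomputable def triMat (x y : F) : Matrix (Fin 2) (Fin 2) F := !![F.signMap x, y; 0, x]

lemma triMat_mem {n : ℤ} {x y : F} (hx : x ∈ F.gr n) (hy : y ∈ F.gr (n + 1)) :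
    triMat x y ∈ F.triGr n :=
  ⟨hx, hy, rfl, signMap_of_mem hx⟩

/-- The corner of the product is the signed Leibniz rule, so `x ↦ triMat x (D x)` is multiplicative
exactly when `D` is a derivation of odd degree. -/
lemma triMat_mul (x y x' y' : F) :
    triMat x y * triMat x' y' = triMat (x * x') (F.signMap x * y' + y * x') := by
  simp [triMat, signMap_mul]

lemma triMat_add (x y x' y' : F) : triMat x y + triMat x' y' = triMat (x + x') (y + y') := by
  ext p q
  fin_cases p <;> fin_cases q <;> simp [triMat]

/-- The differential as an algebra morphism to triangular matrices. -/
noncomputable def dHom (F : CDGA.{u}) : F →ₐ[ℚ] Matrix (Fin 2) (Fin 2) F :=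
  AlgHom.ofLinearMap
    { toFun := fun x => triMat x (F.d x)
      map_add' := fun x y => by rw [triMat_add, map_add]
      map_smul' := fun c x => by
        ext p q
        fin_cases p <;> fin_cases q <;> simp [triMat] }
    (by
      change triMat 1 (F.d 1) = 1
      rw [triMat, d_one, signMap_one, Matrix.one_fin_two])
    (by
      intro x y
      change triMat (x * y) (F.d (x * y)) = triMat x (F.d x) * triMat y (F.d y)
      rw [triMat_mul, leibniz_signMap, add_comm])

end Triangular

/-! ### The graded algebra `A ⊗ ΛV` -/

section FreeExt

variable (A : CDGA.{u}) {X : Type u} (deg : X → ℤ)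

/-- `A ⊗ ΛV` with the differential that vanishes on `V`. -/
noncomputable abbrev freeExt : CDGA.{u} := A.tensor (lam deg)

variable {deg}

variable (deg) in
/-- The generators of `ΛV`. -/
noncomputable def lamGen (x : X) : lam deg := lamι deg x

lemma lam_induction' {p : lam deg → Prop} (w : lam deg)
    (algebraMap : ∀ r : ℚ, p (algebraMap ℚ (lam deg) r)) (gen : ∀ x, p (lamGen deg x))
    (mul : ∀ x y, p x → p y → p (x * y)) (add : ∀ x y, p x → p y → p (x + y)) : p w :=
  lam_induction w algebraMap gen mul add

/-- The generators of `A ⊗ ΛV`. -/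
noncomputable def genEl (x : X) : A.freeExt deg := tmul 1 (lamGen deg x)

variable {A}

lemma genEl_mem (x : X) : genEl A x ∈ (A.freeExt deg).gr (deg x) :=
  tmul_one_mem (B := lam deg) (lamι_mem x)

lemma freeExt_induction {p : A.freeExt deg → Prop} (x : A.freeExt deg)
    (base : ∀ a : A, p (inclLeft A (lam deg) a)) (gen : ∀ x, p (genEl A x))
    (mul : ∀ x y, p x → p y → p (x * y)) (add : ∀ x y, p x → p y → p (x + y)) : p x := by
  induction x using tmul_induction with
  | add x y hx hy => exact add _ _ hx hy
  | tmul a b =>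
    rw [← tmul_one_mul_one_tmul]
    refine mul _ _ (base a) ?_
    change p (inclRight A (lam deg) b)
    clear * - base gen mul add
    induction b using lam_induction' with
    | algebraMap r =>
      have : inclRight A (lam deg) (algebraMap ℚ (lam deg) r) =
          inclLeft A (lam deg) (algebraMap ℚ A r) := by
        rw [AlgHom.commutes, AlgHom.commutes]
      exact this ▸ base _
    | gen x => exact gen x
    | mul x y hx hy => exact (map_mul (inclRight A (lam deg)) x y) ▸ mul _ _ hx hy
    | add x y hx hy => exact (map_add (inclRight A (lam deg)) x y) ▸ add _ _ hx hy

/-- The algebra morphism `A ⊗ ΛV → T` given by its values on `A` and on the basis of `V`; it is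
graded for a graded commutative family of subspaces of `T`. -/
lemma exists_freeExt_lift {T : Type*} [Ring T] [Algebra ℚ T] (G : ℤ → Submodule ℚ T)
    [SetLike.GradedMonoid G]
    (hG : ∀ {i j : ℤ} {a b : T}, a ∈ G i → b ∈ G j → a * b = (i * j).negOnePow • (b * a))
    (f : A →ₐ[ℚ] T) (hf : ∀ ⦃i : ℤ⦄ ⦃a : A⦄, a ∈ A.gr i → f a ∈ G i)
    (v : X → T) (hv : ∀ x, v x ∈ G (deg x)) :
    ∃ g : A.freeExt deg →ₐ[ℚ] T, (∀ a, g (inclLeft A (lam deg) a) = f a) ∧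
      (∀ x, g (genEl A x) = v x) ∧
      ∀ {n : ℤ} {x : A.freeExt deg}, x ∈ (A.freeExt deg).gr n → g x ∈ G n := by
  obtain ⟨w, hwx, hw⟩ : ∃ w : lam deg →ₐ[ℚ] T, (∀ x, w (lamGen deg x) = v x) ∧
      ∀ ⦃i : ℤ⦄ ⦃b : lam deg⦄, b ∈ (lam deg).gr i → w b ∈ G i :=
    ⟨lamHom v fun x y => hG (hv x) (hv y), lamHom_lamι v _, fun i b hb =>
      map_mem_of_map_lamι_mem G (fun x => by rw [lamHom_lamι]; exact hv x) hb⟩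
  have h : ∀ ⦃i j : ℤ⦄ ⦃a : A⦄ ⦃b : lam deg⦄, a ∈ A.gr i → b ∈ (lam deg).gr j →
      f a * w b = (j * i).negOnePow • (w b * f a) := fun i j a b ha hb => by
    rw [mul_comm j]; exact hG (hf ha) (hw hb)
  refine ⟨tensorLift (B := lam deg) f w h, fun a => ?_, fun x => ?_, fun hx => ?_⟩
  · exact (tensorLift_tmul (B := lam deg) f w h a 1).trans (by rw [map_one w, mul_one])
  · exact (tensorLift_tmul (B := lam deg) f w h 1 _).trans (by rw [map_one, one_mul, hwx])
  · exact tensorLift_mem (B := lam deg) G f w h hf hw hx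

/-- A derivation of degree `1` of `A ⊗ ΛV` extending the differential of `A` may be prescribed on
the basis of `V`. -/
lemma exists_derivation (y : X → A.freeExt deg)
    (hy : ∀ x, y x ∈ (A.freeExt deg).gr (deg x + 1)) :
    ∃ D : A.freeExt deg →ₗ[ℚ] A.freeExt deg,
      (∀ a, D (inclLeft A (lam deg) a) = inclLeft A (lam deg) (A.d a)) ∧
      (∀ x, D (genEl A x) = y x) ∧
      (∀ {n : ℤ} {x : A.freeExt deg}, x ∈ (A.freeExt deg).gr n →
        D x ∈ (A.freeExt deg).gr (n + 1)) ∧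
      ∀ a b, D (a * b) = D a * b + (A.freeExt deg).signMap a * D b := by
  obtain ⟨g, hga, hgx, hg⟩ := exists_freeExt_lift (A := A) (deg := deg) (A.freeExt deg).triGr
    triGr_comm ((dHom (A.freeExt deg)).comp (inclLeft A (lam deg)).toAlgHom)
    (fun i a ha => triMat_mem ((inclLeft A (lam deg)).map_gr ha)
      ((A.freeExt deg).d_mem ((inclLeft A (lam deg)).map_gr ha)))
    (fun x => triMat (genEl A x) (y x)) (fun x => triMat_mem (genEl_mem x) (hy x))
  -- The diagonal of `g x` is as required on generators, hence everywhere; the corner is then the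
  -- derivation sought.
  have key : ∀ x, g x = triMat x (g x 0 1) := by
    intro x
    induction x using freeExt_induction with
    | base a => rw [hga]; rfl
    | gen x => rw [hgx]; rfl
    | mul x y hx hy => rw [map_mul, hx, hy, triMat_mul]; rfl
    | add x y hx hy => rw [map_add, hx, hy, triMat_add]; rfl
  refine ⟨{ toFun := fun x => g x 0 1, map_add' := fun x y => ?_, map_smul' := fun c x => ?_ },
    fun a => ?_, fun x => ?_, fun hx => (hg hx).2.1, fun a b => ?_⟩
  · rw [map_add]; rfl
  · rw [map_smul]; rfl
  · change g _ 0 1 = _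
    rw [hga, (inclLeft A (lam deg)).map_d]; rfl
  · change g _ 0 1 = _
    rw [hgx]; rfl
  · change g (a * b) 0 1 = g a 0 1 * b + _ * g b 0 1
    rw [map_mul, key a, key b, triMat_mul, add_comm]; rfl

/-- Replace the differential of a CDGA. -/
def withD (F : CDGA.{u}) (D : F →ₗ[ℚ] F)
    (hdeg : ∀ {n : ℤ} {x : F}, x ∈ F.gr n → D x ∈ F.gr (n + 1))
    (hmul : ∀ a b, D (a * b) = D a * b + F.signMap a * D b) (hD : ∀ x, D (D x) = 0) :
    CDGA.{u} where
  carrier := F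
  gr := F.gr
  d := D
  mul_comm' := F.mul_comm'
  d_mem := hdeg
  d_d := hD
  leibniz b ha := by rw [hmul, signMap_of_mem ha, units_smul_mul]

end FreeExt

/-! ### Cohomology in terms of elements -/

section Elements

variable {A B C : CDGA.{u}}

lemma Hom.cohomologyMap_mk (f : Hom A B) (z : A.cocycles) :
    f.cohomologyMap (Submodule.Quotient.mk z) = Submodule.Quotient.mk (f.cocyclesMap z) := rfl

lemma mk_eq_zero_iff (z : A.cocycles) :
    (Submodule.Quotient.mk z : A.Cohomology) = 0 ↔ ∃ w, A.d w = z :=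
  Submodule.Quotient.mk_eq_zero _

lemma Hom.homologyInjective_iff (f : Hom A B) :
    f.HomologyInjective ↔ ∀ z, A.d z = 0 → ∀ c, f z = B.d c → ∃ w, z = A.d w := by
  rw [Hom.HomologyInjective, injective_iff_map_eq_zero]
  constructor
  · intro h z hz c hc
    obtain ⟨w, hw⟩ := (mk_eq_zero_iff (⟨z, hz⟩ : A.cocycles)).1
      (h _ ((mk_eq_zero_iff _).2 ⟨c, hc.symm⟩))
    exact ⟨w, hw.symm⟩
  · intro h x hx
    obtain ⟨⟨z, hz⟩, rfl⟩ := Submodule.Quotient.mk_surjective _ x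
    rw [f.cohomologyMap_mk] at hx
    obtain ⟨c, hc⟩ := (mk_eq_zero_iff _).1 hx
    obtain ⟨w, hw⟩ := h z hz c hc.symm
    exact (mk_eq_zero_iff _).2 ⟨w, hw.symm⟩

lemma Hom.cohomologyMap_surjective_iff (f : Hom A B) :
    Function.Surjective f.cohomologyMap ↔
      ∀ z, B.d z = 0 → ∃ a, A.d a = 0 ∧ ∃ c, z = f a + B.d c := by
  constructor
  · intro h z hz
    obtain ⟨x, hx⟩ := h (Submodule.Quotient.mk ⟨z, hz⟩)
    obtain ⟨⟨a, ha⟩, rfl⟩ := Submodule.Quotient.mk_surjective _ x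
    rw [f.cohomologyMap_mk, eq_comm, ← sub_eq_zero, ← Submodule.Quotient.mk_sub] at hx
    obtain ⟨c, hc⟩ := (mk_eq_zero_iff _).1 hx
    exact ⟨a, ha, c, by rw [hc]; exact (add_sub_cancel (f a) z).symm⟩
  · intro h x
    obtain ⟨⟨z, hz⟩, rfl⟩ := Submodule.Quotient.mk_surjective _ x
    obtain ⟨a, ha, c, hc⟩ := h z hz
    refine ⟨Submodule.Quotient.mk ⟨a, ha⟩, ?_⟩
    rw [f.cohomologyMap_mk, eq_comm, ← sub_eq_zero, ← Submodule.Quotient.mk_sub, mk_eq_zero_iff]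
    exact ⟨c, by rw [eq_comm]; exact sub_eq_of_eq_add' hc⟩

lemma Hom.quasiIso_iff (f : Hom A B) :
    f.QuasiIso ↔ (∀ z, A.d z = 0 → ∀ c, f z = B.d c → ∃ w, z = A.d w) ∧
      ∀ z, B.d z = 0 → ∃ a, A.d a = 0 ∧ ∃ c, z = f a + B.d c :=
  and_congr f.homologyInjective_iff f.cohomologyMap_surjective_iff

/-- Composition of morphisms of CDGAs. -/
def Hom.comp (g : Hom B C) (f : Hom A B) : Hom A C where
  toAlgHom := g.toAlgHom.comp f.toAlgHom
  map_gr h := g.map_gr (f.map_gr h)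
  map_d a := by simp only [AlgHom.comp_apply, f.map_d, g.map_d]

@[simp] lemma Hom.comp_apply (g : Hom B C) (f : Hom A B) (a : A) : g.comp f a = g (f a) := rfl

lemma Hom.cohomologyMap_comp (g : Hom B C) (f : Hom A B) :
    ⇑(g.comp f).cohomologyMap = g.cohomologyMap ∘ f.cohomologyMap := by
  ext x
  obtain ⟨z, rfl⟩ := Submodule.Quotient.mk_surjective _ x
  rfl

lemma Hom.QuasiIso.comp {g : Hom B C} {f : Hom A B} (hg : g.QuasiIso) (hf : f.QuasiIso) :
    (g.comp f).QuasiIso := by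
  rw [Hom.QuasiIso, Hom.cohomologyMap_comp]
  exact Function.Bijective.comp hg hf

lemma Hom.HomologyInjective.comp {g : Hom B C} {f : Hom A B} (hg : g.HomologyInjective)
    (hf : f.HomologyInjective) : (g.comp f).HomologyInjective := by
  rw [Hom.HomologyInjective, Hom.cohomologyMap_comp]
  exact Function.Injective.comp hg hf

lemma Hom.HomologyInjective.of_comp {g : Hom B C} {f : Hom A B}
    (h : (g.comp f).HomologyInjective) : f.HomologyInjective := by
  rw [Hom.HomologyInjective, Hom.cohomologyMap_comp] at h
  exact Function.Injective.of_comp h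

end Elements

/-! ### Existence of relative Sullivan models -/

/-- Formal expressions in the elements of `A` and in generators which are themselves labelled by an
expression (their differential), an element of `P` (their image) and a degree. -/
inductive Expr (A P : Type u) : Type u
  | base (a : A) : Expr A P
  | gen (t : Expr A P) (c : P) (n : ℤ) : Expr A P
  | add (s t : Expr A P) : Expr A P
  | mul (s t : Expr A P) : Expr A P

/-- The labels of the generators. -/
abbrev Label (A P : Type u) : Type u := Expr A P × P × ℤ

/-- The degree of a generator. -/
abbrev labelDeg {A P : Type u} (g : Label A P) : ℤ := g.2.2

/-- The nesting depth of an expression. -/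
def Expr.depth {A P : Type u} : Expr A P → ℕ
  | base _ => 0
  | gen t _ _ => t.depth + 1
  | add s t => max s.depth t.depth
  | mul s t => max s.depth t.depth

section Model

variable {A P : CDGA.{u}}

variable (A P) in
/-- The graded algebra underlying the relative Sullivan model. -/
noncomputable abbrev modelAlg : CDGA.{u} := A.freeExt (labelDeg (A := A) (P := P))

/-- The condition under which a generator with differential `x.1`, given that `x.1` has
differential `x.2.1` and image `x.2.2`, may have image `c` and degree `n`. -/
def IsValid (x : modelAlg A P × modelAlg A P × P) (c : P) (n : ℤ) : Prop :=
  c ∈ P.gr n ∧ x.1 ∈ (modelAlg A P).gr (n + 1) ∧ x.2.1 = 0 ∧ x.2.2 = P.d c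

open Classical in
/-- The value of an expression, its differential and its image. -/
noncomputable def Expr.eval (f : Hom A P) : Expr A P → modelAlg A P × modelAlg A P × P
  | base a => (inclLeft A (lam labelDeg) a, inclLeft A (lam labelDeg) (A.d a), f a)
  | gen t c n => (genEl A (t, c, n), if IsValid (t.eval f) c n then (t.eval f).1 else 0,
      if IsValid (t.eval f) c n then c else 0)
  | add s t => s.eval f + t.eval f
  | mul s t => ((s.eval f).1 * (t.eval f).1,
      (s.eval f).2.1 * (t.eval f).1 + (modelAlg A P).signMap (s.eval f).1 * (t.eval f).2.1,
      (s.eval f).2.2 * (t.eval f).2.2)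

/-- Scalars need no constructor of their own, since they come from elements of `A`. -/
lemma Expr.exists_eval_eq (f : Hom A P) (x : modelAlg A P) : ∃ t : Expr A P, (t.eval f).1 = x := by
  induction x using freeExt_induction with
  | base a => exact ⟨base a, rfl⟩
  | gen g => exact ⟨gen g.1 g.2.1 g.2.2, rfl⟩
  | mul x y hx hy =>
    obtain ⟨s, rfl⟩ := hx
    obtain ⟨t, rfl⟩ := hy
    exact ⟨mul s t, rfl⟩
  | add x y hx hy =>
    obtain ⟨s, rfl⟩ := hx
    obtain ⟨t, rfl⟩ := hy
    exact ⟨add s t, rfl⟩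

/-- Each use of a generator raises the depth by one, so the generators occurring have labels of
depth strictly below `k`. This gives the Sullivan condition. -/
lemma Expr.eval_mem_adjoin (f : Hom A P) (t : Expr A P) {k : ℕ} (hk : t.depth ≤ k) :
    (t.eval f).1 ∈ Algebra.adjoin ℚ (Set.range (inclLeft A (lam labelDeg)).toAlgHom ∪
      genEl A '' {g : Label A P | g.1.depth < k}) := by
  induction t with
  | base a => exact Algebra.subset_adjoin (Or.inl ⟨a, rfl⟩)
  | gen t c n _ => exact Algebra.subset_adjoin (Or.inr ⟨(t, c, n), hk, rfl⟩)
  | add s t hs ht =>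
    exact add_mem (hs ((le_max_left _ _).trans hk)) (ht ((le_max_right _ _).trans hk))
  | mul s t hs ht =>
    exact mul_mem (hs ((le_max_left _ _).trans hk)) (ht ((le_max_right _ _).trans hk))

/-- Every morphism of CDGAs has a relative Sullivan model. -/
theorem exists_relativeSullivanModel (f : Hom A P) :
    ∃ (S : CDGA.{u}) (i : Hom A S), IsRelativeSullivanModel f i := by
  classical
  let F := modelAlg A P
  -- An invalid label gives a generator with zero differential and zero image. Thus every label may
  -- be used, and the free algebra is fixed before validity is tested.
  let val : Label A P → F × F × P := fun g => (Expr.gen g.1 g.2.1 g.2.2).eval f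
  have val_eq (g : Label A P) : val g = (genEl A g,
      if IsValid (g.1.eval f) g.2.1 g.2.2 then (g.1.eval f).1 else 0,
      if IsValid (g.1.eval f) g.2.1 g.2.2 then g.2.1 else 0) := rfl
  obtain ⟨D, hDa, hDx, hDgr, hDmul⟩ := exists_derivation (A := A) (fun g => (val g).2.1) (by
    intro g
    rw [val_eq]
    dsimp only
    split_ifs with h
    · exact h.2.1
    · exact Submodule.zero_mem _)
  obtain ⟨q, hqa, hqx, hqgr⟩ := exists_freeExt_lift (A := A) P.gr P.mul_comm' f.toAlgHom
    (fun _ _ => f.map_gr) (fun g : Label A P => (val g).2.2) (by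
    intro g
    rw [val_eq]
    dsimp only
    split_ifs with h
    · exact h.1
    · exact Submodule.zero_mem _)
  -- The formal differential and image, by which validity was tested, agree with the actual `D` and
  -- `q`.
  have heval (t : Expr A P) : D (t.eval f).1 = (t.eval f).2.1 ∧ q (t.eval f).1 = (t.eval f).2.2 := by
    induction t with
    | base a => exact ⟨hDa a, hqa a⟩
    | gen t c n _ => exact ⟨hDx (t, c, n), hqx (t, c, n)⟩
    | add s t hs ht =>
      exact ⟨(map_add D _ _).trans (congrArg₂ _ hs.1 ht.1),
        (map_add q _ _).trans (congrArg₂ _ hs.2 ht.2)⟩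
    | mul s t hs ht =>
      simp only [Expr.eval]
      rw [hDmul, map_mul, hs.1, ht.1, hs.2, ht.2]
      exact ⟨rfl, rfl⟩
  have hDs (x : modelAlg A P) : (modelAlg A P).signMap (D x) = - D ((modelAlg A P).signMap x) := signMap_odd hDgr x
  have hqs (x : F) : P.signMap (q x) = q (F.signMap x) := by
    induction x using homogeneous_induction with
    | add x y hx hy => simp only [map_add, hx, hy]
    | hom i a ha =>
      rw [signMap_of_mem ha, signMap_of_mem (hqgr ha)]
      exact (map_units_smul q.toLinearMap.toAddMonoidHom _ _).symm
  -- On a generator this is the cocycle condition in `IsValid`; on a product the cross terms cancel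
  -- because `D` anticommutes with the sign involution.
  have hDD (x : F) : D (D x) = 0 := by
    induction x using freeExt_induction with
    | base a => rw [hDa, hDa, A.d_d, map_zero]
    | gen g =>
      rw [hDx, val_eq]
      dsimp only
      split_ifs with h
      · rw [(heval g.1).1, h.2.2.1]
      · rw [map_zero]
    | mul x y hx hy =>
      rw [hDmul, map_add, hDmul, hDmul, hx, hy, hDs, zero_mul, mul_zero, neg_mul]
      abel
    | add x y hx hy => rw [map_add, map_add, hx, hy, add_zero]
  have hqD (x : F) : q (D x) = P.d (q x) := by
    induction x using freeExt_induction with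
    | base a => rw [hDa, hqa, hqa, f.map_d]
    | gen g =>
      rw [hDx, hqx, val_eq]
      dsimp only
      split_ifs with h
      · rw [(heval g.1).2, h.2.2.2]
      · rw [map_zero, map_zero]
    | mul x y hx hy =>
      rw [hDmul, map_add, map_mul, map_mul, map_mul, leibniz_signMap, hx, hy, hqs]
    | add x y hx hy => rw [map_add, map_add, map_add, map_add, hx, hy]
  -- The property for which the generators were adjoined: a homogeneous cocycle whose image is the
  -- boundary of `c` is bounded by a generator with image `c`. It yields both halves of the
  -- quasi-isomorphism.
  have hgen {z : F} {c : P} {n : ℤ} (hc : c ∈ P.gr n) (hz : z ∈ F.gr (n + 1)) (hDz : D z = 0)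
      (hqz : q z = P.d c) : ∃ x : F, D x = z ∧ q x = c := by
    obtain ⟨t, rfl⟩ := Expr.exists_eval_eq f z
    have hv : IsValid (t.eval f) c n :=
      ⟨hc, hz, (heval t).1.symm.trans hDz, (heval t).2.symm.trans hqz⟩
    refine ⟨genEl A (t, c, n), ?_, ?_⟩
    · rw [hDx, val_eq]
      exact if_pos hv
    · rw [hqx, val_eq]
      exact if_pos hv
  let S : CDGA.{u} := F.withD D hDgr hDmul hDD
  let i : Hom A S :=
    { toAlgHom := (inclLeft A (lam labelDeg)).toAlgHom
      map_gr := (inclLeft A (lam labelDeg)).map_gr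
      map_d := fun a => (hDa a).symm }
  let Q : Hom S P := { toAlgHom := q, map_gr := hqgr, map_d := hqD }
  refine ⟨S, i, ⟨Label A P, labelDeg, genEl A, genEl_mem, ?_, fun g => g.1.depth, ?_⟩, Q,
    Q.quasiIso_iff.2 ⟨?_, ?_⟩, hqa⟩
  · have hL : (lamLift (S := S) (genEl A) genEl_mem).comp
        (freeGCEquiv labelDeg).symm.toAlgHom = inclRight A (lam labelDeg) :=
      lam_algHom_ext fun g => lamLift_lamι (S := S) (genEl A) genEl_mem g
    -- The multiplication map is just the identification of the plain tensor product with the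
    -- underlying space of the graded one.
    have hmul : mulMap i (genEl A) genEl_mem = (tensorOf A (lam labelDeg)).toLinearMap := by
      refine TensorProduct.ext' fun a w => ?_
      have hw := DFunLike.congr_fun hL (freeGCEquiv labelDeg w)
      have e (x : modelAlg A P) (b : lam (labelDeg (A := A) (P := P))) (h : x = tmul 1 b) :
          tmul a 1 * x = tmul a b := by rw [h, tmul_one_mul_one_tmul]
      exact e _ (freeGCEquiv labelDeg w) hw
    rw [hmul]
    exact (tensorOf A (lam labelDeg)).bijective
  · intro g
    change D (genEl A g) ∈ _
    rw [hDx, val_eq]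
    dsimp only
    split_ifs with h
    · exact g.1.eval_mem_adjoin f le_rfl
    · exact zero_mem _
  · intro (z : modelAlg A P) hz c hc
    change D z = 0 at hz
    change q z = P.d c at hc
    -- Generators are homogeneous, so `z` is bounded one component at a time. The generator for
    -- degree `n + 1` has degree `n`, whence the shift in the sum below.
    have hcomp (n : ℤ) : ∃ x : modelAlg A P, D x = (modelAlg A P).comp (n + 1) z := by
      obtain ⟨x, hx, _⟩ := hgen (comp_mem n c) (comp_mem (n + 1) z)
        ((comp_additive D.toAddMonoidHom 1 hDgr (n + 1) z).symm.trans
          ((congrArg _ hz).trans (comp_zero _)))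
        (by rw [← comp_d, ← hc]; exact (Hom.comp_map Q (n + 1) z).symm)
      exact ⟨x, hx⟩
    choose x hx using hcomp
    obtain ⟨s, hs⟩ := exists_finset_sum_comp z
    refine ⟨∑ n ∈ s, x (n - 1), ?_⟩
    refine Eq.trans ?_ (map_sum D _ _).symm
    refine hs.symm.trans (Finset.sum_congr rfl fun n _ => ?_)
    rw [hx, sub_add_cancel]
  · intro z hz
    -- With zero as prescribed boundary, each component of a cocycle of `P` is the image of a
    -- cocycle.
    have hcomp (n : ℤ) : ∃ x : F, D x = 0 ∧ q x = P.comp n z :=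
      hgen (comp_mem n z) (Submodule.zero_mem _) (map_zero _)
        (by rw [map_zero, ← comp_d, hz, comp_zero])
    choose x hx hqx' using hcomp
    obtain ⟨s, hs⟩ := exists_finset_sum_comp z
    refine ⟨∑ n ∈ s, x n, (map_sum D _ _).trans (Finset.sum_eq_zero fun n _ => hx n), 0, ?_⟩
    rw [map_zero, add_zero]
    refine Eq.trans ?_ (map_sum q _ _).symm
    exact hs.symm.trans (Finset.sum_congr rfl fun n _ => (hqx' n).symm)

end Model

end CDGA

/-- Over a field, an endomorphism of a complex that vanishes on cohomology is null-homotopic. -/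
lemma LinearMap.exists_nullHomotopy {K V : Type*} [Field K] [AddCommGroup V] [Module K V]
    {d c : V →ₗ[K] V} (hd : ∀ x, d (d x) = 0) (hcd : ∀ x, c (d x) = d (c x))
    (hc : ∀ z, d z = 0 → ∃ w, c z = d w) : ∃ h : V →ₗ[K] V, ∀ x, c x = d (h x) + h (d x) := by
  obtain ⟨τ, hτ⟩ := d.rangeRestrict.exists_rightInverse_of_surjective d.range_rangeRestrict
  obtain ⟨σ, hσ⟩ := τ.exists_extend
  have hdσ (x : V) : d (σ (d x)) = d x := by
    have h1 : σ (d x) = τ (d.rangeRestrict x) := DFunLike.congr_fun hσ (d.rangeRestrict x)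
    have h2 := congrArg Subtype.val (DFunLike.congr_fun hτ (d.rangeRestrict x))
    rw [h1]
    exact h2
  have hσc (z : V) (hz : d z = 0) : d (σ (c z)) = c z := by
    obtain ⟨w, hw⟩ := hc z hz
    rw [hw, hdσ]
  -- Since `dσd = d`, the first term has total boundary `c(dσ + σd)`. The remaining operator `1 - dσ
  -- - σd = (1 - σd)(1 - dσ)` takes values in cocycles and kills boundaries; there `c` lands in
  -- boundaries, and `σ` inverts `d`.
  refine ⟨c ∘ₗ σ ∘ₗ d ∘ₗ σ +
    σ ∘ₗ c ∘ₗ (LinearMap.id - σ ∘ₗ d) ∘ₗ (LinearMap.id - d ∘ₗ σ), fun x => ?_⟩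
  simp only [LinearMap.add_apply, LinearMap.comp_apply, LinearMap.sub_apply, LinearMap.id_apply,
    map_add]
  rw [hσc _ (by simp [hdσ]), ← hcd]
  simp only [map_sub, hdσ, hd, map_zero, sub_self, sub_zero, add_zero]
  abel

namespace CDGA

/-! ### Retractions up to homotopy, compatible with the sign involution -/

section Retraction

variable {A B : CDGA.{u}}

/-- A null-homotopy of a sign-preserving endomorphism may be chosen sign-reversing. -/
lemma exists_signed_nullHomotopy {c : A →ₗ[ℚ] A} (hcd : ∀ x, c (A.d x) = A.d (c x))
    (hcs : ∀ x, c (A.signMap x) = A.signMap (c x)) (hc : ∀ z, A.d z = 0 → ∃ w, c z = A.d w) :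
    ∃ h : A →ₗ[ℚ] A, (∀ x, h (A.signMap x) = - A.signMap (h x)) ∧
      ∀ x, c x = A.d (h x) + h (A.d x) := by
  obtain ⟨h, hh⟩ := LinearMap.exists_nullHomotopy A.d_d hcd hc
  -- Averaging `h` with `-shs`, where `s` is the sign involution. The latter is again a
  -- null-homotopy of `c`, as `c` commutes with `s` and `d` anticommutes with it.
  refine ⟨(2⁻¹ : ℚ) • (h - A.signMap ∘ₗ h ∘ₗ A.signMap), fun x => ?_, fun x => ?_⟩
  · simp [signMap_signMap, ← smul_neg]
  · have h1 := hh x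
    have h2 := congrArg A.signMap (hh (A.signMap x))
    rw [hcs, signMap_signMap, map_add, signMap_d] at h2
    have h3 : A.signMap (A.d x) = - A.d (A.signMap x) := signMap_d x
    simp only [LinearMap.smul_apply, LinearMap.sub_apply, LinearMap.comp_apply, h3, map_smul,
      map_sub, map_neg, sub_neg_eq_add]
    have h4 : c x + c x = (A.d (h x) - A.d (A.signMap (h (A.signMap x)))) +
        (h (A.d x) + A.signMap (h (A.d (A.signMap x)))) := by
      nth_rewrite 1 [h1]
      rw [h2]
      abel
    rw [← smul_add, ← h4, ← two_smul ℚ, smul_smul]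
    norm_num

/-- A morphism that is injective on cohomology has a retraction up to homotopy. -/
lemma Hom.HomologyInjective.exists_retraction {f : Hom A B} (hf : f.HomologyInjective) :
    ∃ r : B →ₗ[ℚ] A, (∀ x, r (B.d x) = A.d (r x)) ∧ (∀ x, r (B.signMap x) = A.signMap (r x)) ∧
      ∀ z, A.d z = 0 → ∃ w, r (f z) - z = A.d w := by
  obtain ⟨r, hrd, hdr, hr⟩ : ∃ r : B →ₗ[ℚ] A, (∀ x, r (B.d x) = 0) ∧ (∀ x, A.d (r x) = 0) ∧
      ∀ z, A.d z = 0 → ∃ w, r (f z) - z = A.d w := by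
    -- Taking all of `B` modulo boundaries as target, instead of the cohomology of `B`, makes a
    -- linear left inverse of `F` define a map on the whole of `B`. A linear choice of
    -- representatives then lands in the cocycles of `A`.
    let F : A.Cohomology →ₗ[ℚ] B ⧸ LinearMap.range B.d :=
      A.coboundaries.mapQ (LinearMap.range B.d) (f.toAlgHom.toLinearMap ∘ₗ A.cocycles.subtype) (by
        rintro ⟨a, ha⟩ ⟨c, hc⟩
        exact ⟨f c, by rw [← f.map_d, hc]; rfl⟩)
    have hF : LinearMap.ker F = ⊥ := by
      rw [LinearMap.ker_eq_bot']
      intro x hx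
      obtain ⟨⟨z, hz⟩, rfl⟩ := Submodule.Quotient.mk_surjective _ x
      obtain ⟨c, hc⟩ := (Submodule.Quotient.mk_eq_zero _).1 hx
      obtain ⟨w, hw⟩ := f.homologyInjective_iff.1 hf z hz c hc.symm
      exact (mk_eq_zero_iff _).2 ⟨w, hw.symm⟩
    obtain ⟨l, hl⟩ := F.exists_leftInverse_of_injective hF
    obtain ⟨τ, hτ⟩ := A.coboundaries.mkQ.exists_rightInverse_of_surjective
      (Submodule.range_mkQ _)
    refine ⟨A.cocycles.subtype ∘ₗ τ ∘ₗ l ∘ₗ (LinearMap.range B.d).mkQ, fun x => ?_, fun x => ?_,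
      fun z hz => ?_⟩
    · have : (LinearMap.range B.d).mkQ (B.d x) = 0 :=
        (Submodule.Quotient.mk_eq_zero _).2 ⟨x, rfl⟩
      simp only [LinearMap.comp_apply, this, map_zero]
    · exact (τ (l ((LinearMap.range B.d).mkQ x))).2
    · let zc : A.cocycles := ⟨z, hz⟩
      have h1 : l ((LinearMap.range B.d).mkQ (f z)) = A.coboundaries.mkQ zc :=
        DFunLike.congr_fun hl (A.coboundaries.mkQ zc)
      have h2 : A.coboundaries.mkQ (τ (A.coboundaries.mkQ zc)) = A.coboundaries.mkQ zc :=
        DFunLike.congr_fun hτ (A.coboundaries.mkQ zc)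
      obtain ⟨w, hw⟩ := (Submodule.Quotient.eq _).1 h2
      refine ⟨w, Eq.trans ?_ hw.symm⟩
      simp only [LinearMap.comp_apply, h1]
      rfl
  -- Averaging over conjugation by the sign involution makes `r` commute with it, which tensoring
  -- chain maps requires.
  refine ⟨(2⁻¹ : ℚ) • (r + A.signMap ∘ₗ r ∘ₗ B.signMap), fun x => ?_, fun x => ?_, fun z hz => ?_⟩
  · have h1 : A.d (A.signMap (r (B.signMap x))) = 0 := by
      rw [← neg_eq_zero, ← signMap_d, hdr, map_zero]
    simp [hrd, hdr, h1, signMap_d]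
  · simp [signMap_signMap, add_comm]
  · obtain ⟨w, hw⟩ := hr z hz
    obtain ⟨w', hw'⟩ := hr (A.signMap z) (by rw [← neg_eq_zero, ← signMap_d, hz, map_zero])
    refine ⟨(2⁻¹ : ℚ) • (w - A.signMap w'), ?_⟩
    have h1 : A.signMap (r (B.signMap (f z))) - z = - A.d (A.signMap w') := by
      rw [← signMap_d, ← hw', map_sub, signMap_signMap, f.signMap_map]
    have h2 : z = (2⁻¹ : ℚ) • (z + z) := by
      rw [← two_smul ℚ, smul_smul]; norm_num
    simp only [LinearMap.smul_apply, LinearMap.add_apply, LinearMap.comp_apply, map_smul, map_sub]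
    nth_rewrite 3 [h2]
    rw [← smul_sub, ← hw, sub_eq_add_neg (r (f z) - z), ← h1]
    congr 1
    abel

end Retraction

/-! ### Tensor products of homotopies, in place of the Künneth theorem -/

section TensorMap

variable {A B A' B' : CDGA.{u}}

/-- The tensor product of two linear maps. -/
noncomputable def tmap (f : A →ₗ[ℚ] A') (g : B →ₗ[ℚ] B') : A.tensor B →ₗ[ℚ] A'.tensor B' :=
  (tensorOf A' B').toLinearMap ∘ₗ TensorProduct.map f g ∘ₗ (tensorOf A B).symm.toLinearMap

lemma tmap_tmul (f : A →ₗ[ℚ] A') (g : B →ₗ[ℚ] B') (a : A) (b : B) :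
    tmap f g (tmul a b) = tmul (f a) (g b) := rfl

lemma tmul_neg_left (a : A) (b : B) : tmul (-a) b = - tmul a b := by
  rw [eq_neg_iff_add_eq_zero, ← tmul_add_left, neg_add_cancel, tmul_zero_left]

lemma tmul_sub_left (a a' : A) (b : B) : tmul (a - a') b = tmul a b - tmul a' b := by
  rw [sub_eq_add_neg, tmul_add_left, tmul_neg_left, sub_eq_add_neg]

lemma tmul_sub_right (a : A) (b b' : B) : tmul a (b - b') = tmul a b - tmul a b' := by
  rw [eq_sub_iff_add_eq, ← tmul_add_right, sub_add_cancel]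

lemma tmap_d {r₁ : A →ₗ[ℚ] A'} {r₂ : B →ₗ[ℚ] B'} (h₁ : ∀ x, r₁ (A.d x) = A'.d (r₁ x))
    (hs : ∀ x, r₁ (A.signMap x) = A'.signMap (r₁ x)) (h₂ : ∀ x, r₂ (B.d x) = B'.d (r₂ x))
    (x : A.tensor B) : tmap r₁ r₂ ((A.tensor B).d x) = (A'.tensor B').d (tmap r₁ r₂ x) := by
  induction x using tmul_induction with
  | add x y hx hy => simp only [map_add, hx, hy]
  | tmul a b => rw [d_tmul, map_add, tmap_tmul, tmap_tmul, tmap_tmul, d_tmul, h₁, hs, h₂]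

/-- The tensor product of two endomorphisms homotopic to the identity is homotopic to the
identity. -/
lemma tmap_sub_self {e₁ h₁ : A →ₗ[ℚ] A} {e₂ h₂ : B →ₗ[ℚ] B}
    (hs : ∀ x, h₁ (A.signMap x) = - A.signMap (h₁ x)) (he₂ : ∀ x, e₂ (B.d x) = B.d (e₂ x))
    (H₁ : ∀ x, e₁ x - x = A.d (h₁ x) + h₁ (A.d x)) (H₂ : ∀ x, e₂ x - x = B.d (h₂ x) + h₂ (B.d x))
    (x : A.tensor B) : tmap e₁ e₂ x - x = (A.tensor B).d ((tmap h₁ e₂ + tmap A.signMap h₂) x) +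
      (tmap h₁ e₂ + tmap A.signMap h₂) ((A.tensor B).d x) := by
  induction x using tmul_induction with
  | add x y hx hy => rw [map_add, add_sub_add_comm, hx, hy]; simp only [map_add]; abel
  | tmul a b =>
    simp only [LinearMap.add_apply, d_tmul, map_add, tmap_tmul]
    rw [hs, he₂, signMap_d, signMap_signMap, tmul_neg_left, tmul_neg_left]
    -- Changing one factor at a time explains the homotopy `h₁ ⊗ e₂ + s ⊗ h₂`, with `s` the sign
    -- involution; `hs` and `signMap_d` cancel the mixed terms.
    have e : tmul (e₁ a) (e₂ b) - tmul a b = tmul (e₁ a - a) (e₂ b) + tmul a (e₂ b - b) := by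
      rw [tmul_sub_left, tmul_sub_right]; abel
    rw [e, H₁, H₂, tmul_add_left, tmul_add_right]
    abel

/-- Homotopy retractions `r₁`, `r₂` make `(r₁ ⊗ r₂)(f ⊗ g)` homotopic to the identity, so a cocycle
whose image bounds is itself a boundary. -/
theorem Hom.HomologyInjective.tensor {f : Hom A A'} {g : Hom B B'} (hf : f.HomologyInjective)
    (hg : g.HomologyInjective) : (f.tensor g).HomologyInjective := by
  obtain ⟨r₁, hd₁, hs₁, hr₁⟩ := hf.exists_retraction
  obtain ⟨r₂, hd₂, hs₂, hr₂⟩ := hg.exists_retraction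
  obtain ⟨h₁, hh₁, H₁⟩ := exists_signed_nullHomotopy
    (c := r₁ ∘ₗ f.toAlgHom.toLinearMap - LinearMap.id)
    (fun x => by simp [f.map_d, hd₁]) (fun x => by simp [← f.signMap_map, hs₁]) hr₁
  obtain ⟨h₂, hh₂, H₂⟩ := exists_signed_nullHomotopy
    (c := r₂ ∘ₗ g.toAlgHom.toLinearMap - LinearMap.id)
    (fun x => by simp [g.map_d, hd₂]) (fun x => by simp [← g.signMap_map, hs₂]) hr₂
  have key := tmap_sub_self (e₁ := r₁ ∘ₗ f.toAlgHom.toLinearMap)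
    (e₂ := r₂ ∘ₗ g.toAlgHom.toLinearMap) hh₁ (fun x => by simp [g.map_d, hd₂]) H₁ H₂
  have hcomp (x : A.tensor B) : tmap (r₁ ∘ₗ f.toAlgHom.toLinearMap)
      (r₂ ∘ₗ g.toAlgHom.toLinearMap) x = tmap r₁ r₂ (f.tensor g x) := by
    induction x using tmul_induction with
    | add x y hx hy => simp only [map_add, hx, hy]
    | tmul a b => rfl
  rw [Hom.homologyInjective_iff]
  intro z hz c hc
  have := key z
  rw [hz, map_zero, add_zero, hcomp, hc, tmap_d hd₁ hs₁ hd₂, sub_eq_iff_eq_add,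
    ← sub_eq_iff_eq_add', ← map_sub] at this
  exact ⟨_, this.symm⟩

/-- The retraction `r` given by injectivity is a two-sided homotopy inverse: every class of `B`
comes from `A`, so `f r - 1` vanishes on cohomology and is null-homotopic. -/
lemma Hom.QuasiIso.exists_inverse {f : Hom A B} (hf : f.QuasiIso) :
    ∃ r : B →ₗ[ℚ] A, (∀ x, r (B.d x) = A.d (r x)) ∧ (∀ x, r (B.signMap x) = A.signMap (r x)) ∧
      ∃ h : B →ₗ[ℚ] B, (∀ x, h (B.signMap x) = - B.signMap (h x)) ∧
        ∀ x, f (r x) - x = B.d (h x) + h (B.d x) := by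
  obtain ⟨r, hd, hs, hr⟩ := Hom.HomologyInjective.exists_retraction hf.1
  refine ⟨r, hd, hs, exists_signed_nullHomotopy (c := f.toAlgHom.toLinearMap ∘ₗ r - LinearMap.id)
    (fun x => by simp [f.map_d, hd]) (fun x => by simp [f.signMap_map, hs]) fun z hz => ?_⟩
  obtain ⟨a, ha, c, rfl⟩ := (f.quasiIso_iff.1 hf).2 z hz
  obtain ⟨w, hw⟩ := hr a ha
  -- For `z = f a + d c` one has `f r z - z = f (r f a - a) + d (f r c - c)`, and `r f a - a = d w`.
  refine ⟨f w + f (r c) - c, ?_⟩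
  have hw' := congrArg f.toAlgHom hw
  rw [map_sub, f.map_d] at hw'
  simp only [LinearMap.sub_apply, LinearMap.comp_apply, LinearMap.id_apply, map_add, hd,
    AlgHom.toLinearMap_apply, f.map_d, map_sub, ← hw']
  abel

theorem Hom.QuasiIso.tensor {f : Hom A A'} {g : Hom B B'} (hf : f.QuasiIso) (hg : g.QuasiIso) :
    (f.tensor g).QuasiIso := by
  refine ⟨Hom.HomologyInjective.tensor hf.1 hg.1, ?_⟩
  obtain ⟨r₁, hd₁, hs₁, h₁, hh₁, H₁⟩ := hf.exists_inverse
  obtain ⟨r₂, hd₂, hs₂, h₂, hh₂, H₂⟩ := hg.exists_inverse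
  have key := tmap_sub_self (e₁ := f.toAlgHom.toLinearMap ∘ₗ r₁)
    (e₂ := g.toAlgHom.toLinearMap ∘ₗ r₂) hh₁ (fun x => by simp [g.map_d, hd₂]) H₁ H₂
  have hcomp (x : A'.tensor B') : tmap (f.toAlgHom.toLinearMap ∘ₗ r₁)
      (g.toAlgHom.toLinearMap ∘ₗ r₂) x = f.tensor g (tmap r₁ r₂ x) := by
    induction x using tmul_induction with
    | add x y hx hy => simp only [map_add, hx, hy]
    | tmul a b => rfl
  rw [Hom.cohomologyMap_surjective_iff]
  intro z hz
  have := key z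
  rw [hz, map_zero, add_zero, hcomp] at this
  refine ⟨tmap r₁ r₂ z, ?_, - (tmap h₁ (g.toAlgHom.toLinearMap ∘ₗ r₂) + tmap A'.signMap h₂) z, ?_⟩
  · rw [← tmap_d hd₁ hs₁ hd₂, hz, map_zero]
  · rw [map_neg, ← this]; abel

end TensorMap

/-! ### Pullbacks -/

section Pullback

variable {C T E : CDGA.{u}} (f : Hom C E) (g : Hom T E)

/-- The algebra underlying the pullback of two morphisms of CDGAs. -/
def pullbackAlg : Subalgebra ℚ (C × T) :=
  AlgHom.equalizer (f.toAlgHom.comp (AlgHom.fst ℚ C T)) (g.toAlgHom.comp (AlgHom.snd ℚ C T))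

/-- The grading of the pullback. -/
def pullbackGr (n : ℤ) : Submodule ℚ (pullbackAlg f g) :=
  ((C.gr n).prod (T.gr n)).comap (pullbackAlg f g).val.toLinearMap

variable {f g}

lemma mem_pullbackAlg {x : C × T} : x ∈ pullbackAlg f g ↔ f x.1 = g x.2 := Iff.rfl

lemma comp_sum_of_mem {A : CDGA.{u}} {s : Finset ℤ} {x : ℤ → A} (hx : ∀ i ∈ s, x i ∈ A.gr i)
    {n : ℤ} (hn : n ∈ s) : A.comp n (∑ i ∈ s, x i) = x n := by
  have hsum : A.comp n (∑ i ∈ s, x i) = ∑ i ∈ s, A.comp n (x i) :=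
    map_sum ({ toFun := A.comp n, map_zero' := comp_zero n, map_add' := comp_add n } : A →+ A) x s
  rw [hsum, Finset.sum_eq_single_of_mem n hn fun i hi h => comp_of_mem_ne (hx i hi) h,
    comp_of_mem (hx n hn)]

lemma exists_forall_sum_comp (A : CDGA.{u}) (a : A) :
    ∃ s : Finset ℤ, ∀ t, s ⊆ t → ∑ i ∈ t, A.comp i a = a := by
  classical
  refine ⟨(DirectSum.decompose A.gr a).support, fun t ht => ?_⟩
  refine Eq.trans (Finset.sum_subset ht fun i _ hi => ?_).symm
    (DirectSum.sum_support_decompose A.gr a)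
  simpa [comp] using hi

/-- Components are taken in each coordinate; they stay in the pullback because `f` and `g` commute
with taking components. -/
lemma pullback_isInternal : DirectSum.IsInternal (pullbackGr f g) := by
  classical
  rw [DirectSum.isInternal_submodule_iff_iSupIndep_and_iSup_eq_top]
  constructor
  · rw [iSupIndep_iff_finsetSum_eq_zero_imp_eq_zero]
    intro s x hx h0 n hn
    have h1 : ∑ i ∈ s, ((x i).1.1 : C) = 0 := by
      have := congrArg (fun y : pullbackAlg f g => y.1.1) h0
      simpa [Prod.fst_sum] using this
    have h2 : ∑ i ∈ s, ((x i).1.2 : T) = 0 := by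
      have := congrArg (fun y : pullbackAlg f g => y.1.2) h0
      simpa [Prod.snd_sum] using this
    refine Subtype.ext (Prod.ext ?_ ?_)
    · rw [← comp_sum_of_mem (x := fun i => (x i).1.1) (fun i hi => (hx i hi).1) hn, h1, comp_zero]
      rfl
    · rw [← comp_sum_of_mem (x := fun i => (x i).1.2) (fun i hi => (hx i hi).2) hn, h2, comp_zero]
      rfl
  · rw [eq_top_iff]
    rintro x -
    let c (n : ℤ) : pullbackAlg f g := ⟨(C.comp n x.1.1, T.comp n x.1.2), by
      rw [mem_pullbackAlg, ← f.comp_map, ← g.comp_map, mem_pullbackAlg.1 x.2]⟩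
    obtain ⟨s, hs⟩ := exists_forall_sum_comp C x.1.1
    obtain ⟨t, ht⟩ := exists_forall_sum_comp T x.1.2
    have hx : x = ∑ n ∈ s ∪ t, c n := by
      refine Subtype.ext (Prod.ext ?_ ?_)
      · simp only [AddSubmonoidClass.coe_finsetSum, Prod.fst_sum, c]
        exact (hs _ Finset.subset_union_left).symm
      · simp only [AddSubmonoidClass.coe_finsetSum, Prod.snd_sum, c]
        exact (ht _ Finset.subset_union_right).symm
    rw [hx]
    exact Submodule.sum_mem _ fun n _ =>
      Submodule.mem_iSup_of_mem (p := pullbackGr f g) n ⟨comp_mem n _, comp_mem n _⟩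

noncomputable instance pullbackGraded : GradedAlgebra (pullbackGr f g) where
  one_mem := ⟨SetLike.GradedOne.one_mem, SetLike.GradedOne.one_mem⟩
  mul_mem _ _ _ _ hx hy := ⟨SetLike.mul_mem_graded hx.1 hy.1, SetLike.mul_mem_graded hx.2 hy.2⟩
  toDecomposition := pullback_isInternal.chooseDecomposition

variable (f g) in
/-- The pullback of two morphisms of CDGAs with the same target. -/
noncomputable def pullback : CDGA.{u} where
  carrier := pullbackAlg f g
  gr := pullbackGr f g
  d := ((C.d.prodMap T.d) ∘ₗ (pullbackAlg f g).val.toLinearMap).codRestrict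
    (Subalgebra.toSubmodule (pullbackAlg f g)) fun x => by
      change f (C.d x.1.1) = g (T.d x.1.2)
      rw [f.map_d, g.map_d, mem_pullbackAlg.1 x.2]
  mul_comm' ha hb := by
    refine Subtype.ext (Prod.ext ((C.mul_comm' ha.1 hb.1).trans ?_)
      ((T.mul_comm' ha.2 hb.2).trans ?_))
    · rw [Units.smul_def, Units.smul_def]; rfl
    · rw [Units.smul_def, Units.smul_def]; rfl
  d_mem ha := ⟨C.d_mem ha.1, T.d_mem ha.2⟩
  d_d a := Subtype.ext (Prod.ext (C.d_d _) (T.d_d _))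
  leibniz b ha := by
    refine Subtype.ext (Prod.ext ((C.leibniz b.1.1 ha.1).trans ?_)
      ((T.leibniz b.1.2 ha.2).trans ?_))
    · rw [Units.smul_def, Units.smul_def]; rfl
    · rw [Units.smul_def, Units.smul_def]; rfl

variable (f g) in
/-- The first projection of a pullback. -/
noncomputable def pullbackFst : Hom (pullback f g) C where
  toAlgHom := (AlgHom.fst ℚ C T).comp (pullbackAlg f g).val
  map_gr h := h.1
  map_d _ := rfl

variable (f g) in
/-- The second projection of a pullback. -/
noncomputable def pullbackSnd : Hom (pullback f g) T where
  toAlgHom := (AlgHom.snd ℚ C T).comp (pullbackAlg f g).val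
  map_gr h := h.2
  map_d _ := rfl

/-- The morphism to a pullback given by its two components. -/
noncomputable def pullbackLift {A : CDGA.{u}} (u : Hom A C) (v : Hom A T)
    (h : ∀ a, f (u a) = g (v a)) : Hom A (pullback f g) where
  toAlgHom := (u.toAlgHom.prod v.toAlgHom).codRestrict (pullbackAlg f g) h
  map_gr ha := ⟨u.map_gr ha, v.map_gr ha⟩
  map_d a := Subtype.ext (Prod.ext (u.map_d a) (v.map_d a))

/-- The base change of a surjective quasi-isomorphism is a quasi-isomorphism. -/
theorem pullbackFst_quasiIso (hg : Function.Surjective g) (hq : g.QuasiIso) :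
    (pullbackFst f g).QuasiIso := by
  obtain ⟨hinj, hsurj⟩ := g.quasiIso_iff.1 hq
  rw [Hom.quasiIso_iff]
  have mk (c : C) (t : T) (h : f c = g t) : ∃ x : pullback f g, x.1 = (c, t) := ⟨⟨(c, t), h⟩, rfl⟩
  constructor
  · intro z hz c hc
    replace hc : z.1.1 = C.d c := hc
    have hz2 : T.d z.1.2 = 0 := congrArg (fun y : pullback f g => y.1.2) hz
    obtain ⟨t, ht⟩ := hg (f c)
    have hgz : g z.1.2 = E.d (f c) := by rw [← mem_pullbackAlg.1 z.2, hc, f.map_d]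
    have hy : T.d (z.1.2 - T.d t) = 0 := by rw [map_sub, hz2, T.d_d, sub_zero]
    have hgy : g (z.1.2 - T.d t) = 0 := by rw [map_sub, hgz, g.map_d, ht, sub_self]
    -- After lifting `f c` to `t`, the second coordinate differs from `d t` by a cocycle in the
    -- kernel of `g`, hence by some `d w`. Subtracting `a + d e'` moves `w` into that kernel without
    -- changing `d w`.
    obtain ⟨w, hw⟩ := hinj _ hy 0 (by rw [hgy, map_zero])
    have hgw : E.d (g w) = 0 := by rw [← g.map_d, ← hw, hgy]
    obtain ⟨a, ha, e, he⟩ := hsurj _ hgw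
    obtain ⟨e', rfl⟩ := hg e
    obtain ⟨x, hx⟩ := mk c (t + (w - a - T.d e')) (by
      rw [map_add, ht, map_sub, map_sub, he, g.map_d]; abel)
    refine ⟨x, Subtype.ext (Prod.ext ?_ ?_)⟩
    · change z.1.1 = C.d x.1.1
      rw [hx, hc]
    · change z.1.2 = T.d x.1.2
      rw [hx]
      simp only [map_add, map_sub, ha, T.d_d, ← hw]
      abel
  · intro z hz
    obtain ⟨a, ha, e, he⟩ := hsurj (f z) (by rw [← f.map_d, hz, map_zero])
    obtain ⟨e', rfl⟩ := hg e
    obtain ⟨x, hx⟩ := mk z (a + T.d e') (by rw [map_add, g.map_d, he])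
    refine ⟨x, Subtype.ext (Prod.ext ?_ ?_), 0, ?_⟩
    · change C.d x.1.1 = 0
      rw [hx, hz]
    · change T.d x.1.2 = 0
      rw [hx, map_add, ha, T.d_d, add_zero]
    · change z = x.1.1 + _
      rw [hx, map_zero, add_zero]

end Pullback

/-! ### Powers of the kernel of a tensor product -/

section KernelPowers

variable {A B : CDGA.{u}}

lemma ker_pow_zero (f : Hom A B) : f.ker ^ 0 = ⊤ := by
  rw [Submodule.pow_zero, Ideal.one_eq_top]

lemma isTwoSided_ker_pow (f : Hom A B) : ∀ m : ℕ, (f.ker ^ m).IsTwoSided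
  | 0 => by rw [ker_pow_zero]; infer_instance
  | m + 1 => ((isDGIdeal_ker f).pow_succ m).twoSided

lemma ker_pow_mul_mem_right (f : Hom A B) (m : ℕ) {a b : A} (ha : a ∈ f.ker ^ m) :
    a * b ∈ f.ker ^ m :=
  haveI := isTwoSided_ker_pow f m
  Ideal.mul_mem_right b _ ha

lemma comp_mem_ker_pow (f : Hom A B) (m : ℕ) (n : ℤ) {a : A} (ha : a ∈ f.ker ^ m) :
    A.comp n a ∈ f.ker ^ m := by
  cases m with
  | zero => rw [ker_pow_zero]; trivial
  | succ m => exact ((isDGIdeal_ker f).pow_succ m).homogeneous n ha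

lemma mul_mem_ker_pow_succ (f : Hom A B) (m : ℕ) {a b : A} (ha : a ∈ f.ker ^ m)
    (hb : b ∈ f.ker) : a * b ∈ f.ker ^ (m + 1) := by
  cases m with
  | zero => rw [zero_add, Submodule.pow_one]; exact Ideal.mul_mem_left _ a hb
  | succ m => rw [Submodule.pow_succ]; exact Submodule.mul_mem_mul ha hb

lemma ker_pow_antitone (f : Hom A B) : Antitone fun m => f.ker ^ m := by
  refine antitone_nat_of_succ_le fun m => ?_
  cases m with
  | zero => rw [ker_pow_zero]; exact le_top
  | succ m =>
    rw [Submodule.pow_succ, Submodule.mul_le]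
    exact fun a ha b _ => ker_pow_mul_mem_right f (m + 1) ha

lemma rho_eq_zero_iff (f : Hom A B) (m : ℕ) (a : A) : f.rho m a = 0 ↔ a ∈ f.ker ^ (m + 1) :=
  haveI := isTwoSided_ker_pow f (m + 1)
  Ideal.Quotient.eq_zero_iff_mem

lemma rho_surjective (f : Hom A B) (m : ℕ) : Function.Surjective (f.rho m) :=
  haveI := isTwoSided_ker_pow f (m + 1)
  Ideal.Quotient.mk_surjective

/-- The morphism induced on the quotient by a power of the kernel. -/
lemma exists_rho_lift {E : CDGA.{u}} (f : Hom A B) (m : ℕ) (g : Hom A E)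
    (hg : ∀ a ∈ f.ker ^ (m + 1), g a = 0) :
    ∃ h : Hom (f.kerPowQuotient m) E, ∀ a, h (f.rho m a) = g a := by
  have := isTwoSided_ker_pow f (m + 1)
  refine ⟨{ toAlgHom := Ideal.Quotient.liftₐ (f.ker ^ (m + 1)) g.toAlgHom hg
            map_gr := ?_
            map_d := ?_ }, fun a => rfl⟩
  · rintro i _ ⟨a, ha, rfl⟩
    exact g.map_gr ha
  · intro x
    obtain ⟨a, rfl⟩ := rho_surjective f m x
    exact g.map_d a

variable {A₁ A₂ B₁ B₂ : CDGA.{u}} (f : Hom A₁ B₁) (g : Hom A₂ B₂)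

/-- The span of the tensors of elements of the powers of the two kernels, of total exponent at
least `k`. -/
noncomputable def kerFiltration (k : ℕ) : Submodule ℚ (A₁.tensor A₂) :=
  Submodule.span ℚ {x | ∃ i j : ℕ, k ≤ i + j ∧ ∃ a ∈ f.ker ^ i, ∃ b ∈ g.ker ^ j, x = tmul a b}

variable {f g}

lemma tmul_mem_kerFiltration {i j k : ℕ} (hk : k ≤ i + j) {a : A₁} {b : A₂} (ha : a ∈ f.ker ^ i)
    (hb : b ∈ g.ker ^ j) : tmul a b ∈ kerFiltration f g k :=
  Submodule.subset_span ⟨i, j, hk, a, ha, b, hb, rfl⟩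

/-- The product formula carries a sign depending on the degrees of the inner factors `b` and `a'`,
so these are split into components; membership in a subspace ignores the sign. -/
lemma tmul_mul_tmul_mem {S : Submodule ℚ (A₁.tensor A₂)} {a a' : A₁} {b b' : A₂}
    (h : ∀ p q : ℤ, tmul (a * A₁.comp p a') (A₂.comp q b * b') ∈ S) :
    tmul a b * tmul a' b' ∈ S := by
  obtain ⟨s, hs⟩ := exists_finset_sum_comp a'
  obtain ⟨t, ht⟩ := exists_finset_sum_comp b
  have e₁ : tmul a b = ∑ q ∈ t, tmul a (A₂.comp q b) := by
    conv_lhs => rw [← ht]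
    exact map_sum (AddMonoidHom.mk' (tmul a) (tmul_add_right a)) _ _
  have e₂ : tmul a' b' = ∑ p ∈ s, tmul (A₁.comp p a') b' := by
    conv_lhs => rw [← hs]
    exact map_sum (AddMonoidHom.mk' (tmul · b') fun a a' => tmul_add_left a a' b') _ _
  rw [e₁, e₂, Finset.sum_mul_sum]
  refine Submodule.sum_mem _ fun q _ => Submodule.sum_mem _ fun p _ => ?_
  rw [tmul_mul_tmul a b' (comp_mem q b) (comp_mem p a')]
  exact units_smul_mem _ _ (h p q)

/-- The kernel of a tensor product of surjective morphisms. -/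
lemma mem_span_of_mem_ker_tensor (hf : Function.Surjective f) (hg : Function.Surjective g)
    {x : A₁.tensor A₂} (hx : f.tensor g x = 0) :
    x ∈ Submodule.span ℚ {x | ∃ a b, (a ∈ f.ker ∨ b ∈ g.ker) ∧ x = tmul a b} := by
  obtain ⟨σ, hσ⟩ := f.toAlgHom.toLinearMap.exists_rightInverse_of_surjective
    (LinearMap.range_eq_top.2 hf)
  obtain ⟨τ, hτ⟩ := g.toAlgHom.toLinearMap.exists_rightInverse_of_surjective
    (LinearMap.range_eq_top.2 hg)
  -- With linear sections `σ` and `τ`, the correction term vanishes on the kernel of `f ⊗ g`.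
  have key (y : A₁.tensor A₂) : y - tmap σ τ (f.tensor g y) ∈
      Submodule.span ℚ {x | ∃ a b, (a ∈ f.ker ∨ b ∈ g.ker) ∧ x = tmul a b} := by
    induction y using tmul_induction with
    | add x y hx hy => rw [map_add, map_add, add_sub_add_comm]; exact add_mem hx hy
    | tmul a b =>
      have e : tmul a b - tmul (σ (f a)) (τ (g b)) =
          tmul (a - σ (f a)) b + tmul (σ (f a)) (b - τ (g b)) := by
        rw [tmul_sub_left, tmul_sub_right]; abel
      rw [Hom.tensor_tmul, tmap_tmul, e]
      refine add_mem (Submodule.subset_span ⟨_, _, Or.inl ?_, rfl⟩)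
        (Submodule.subset_span ⟨_, _, Or.inr ?_, rfl⟩)
      · have : f (σ (f a)) = f a := DFunLike.congr_fun hσ (f a)
        change f (a - σ (f a)) = 0
        rw [map_sub, this, sub_self]
      · have : g (τ (g b)) = g b := DFunLike.congr_fun hτ (g b)
        change g (b - τ (g b)) = 0
        rw [map_sub, this, sub_self]
  have := key x
  rwa [hx, map_zero, sub_zero] at this

/-- A kernel element is a sum of tensors with one factor in a kernel, and that factor raises the
corresponding exponent by one. -/
lemma mul_mem_kerFiltration_succ (hf : Function.Surjective f) (hg : Function.Surjective g) {k : ℕ}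
    {x y : A₁.tensor A₂} (hx : x ∈ kerFiltration f g k) (hy : f.tensor g y = 0) :
    x * y ∈ kerFiltration f g (k + 1) := by
  have hy' := mem_span_of_mem_ker_tensor hf hg hy
  clear hy
  induction hx using Submodule.span_induction with
  | zero => rw [zero_mul]; exact Submodule.zero_mem _
  | add _ _ _ _ h h' => rw [add_mul]; exact Submodule.add_mem _ h h'
  | smul c _ _ h => rw [smul_mul_assoc]; exact Submodule.smul_mem _ _ h
  | mem x hx =>
    obtain ⟨i, j, hij, a, ha, b, hb, rfl⟩ := hx
    induction hy' using Submodule.span_induction with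
    | zero => rw [mul_zero]; exact Submodule.zero_mem _
    | add _ _ _ _ h h' => rw [mul_add]; exact Submodule.add_mem _ h h'
    | smul c _ _ h => rw [mul_smul_comm]; exact Submodule.smul_mem _ _ h
    | mem y hy =>
      obtain ⟨a', b', h, rfl⟩ := hy
      refine tmul_mul_tmul_mem fun p q => ?_
      rcases h with h | h
      · refine tmul_mem_kerFiltration (i := i + 1) (j := j) (by omega)
          (mul_mem_ker_pow_succ f i ha ?_)
          (ker_pow_mul_mem_right g j (comp_mem_ker_pow g j q hb))
        exact (isDGIdeal_ker f).homogeneous p h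
      · exact tmul_mem_kerFiltration (i := i) (j := j + 1) (by omega)
          (ker_pow_mul_mem_right f i ha)
          (mul_mem_ker_pow_succ g j (comp_mem_ker_pow g j q hb) h)

lemma ker_tensor_pow_le (hf : Function.Surjective f) (hg : Function.Surjective g) (k : ℕ)
    {x : A₁.tensor A₂} (hx : x ∈ (f.tensor g).ker ^ (k + 1)) : x ∈ kerFiltration f g (k + 1) := by
  induction k generalizing x with
  | zero =>
    rw [zero_add, Submodule.pow_one] at hx
    have h1 : (1 : A₁.tensor A₂) ∈ kerFiltration f g 0 :=
      tmul_mem_kerFiltration (i := 0) (j := 0) le_rfl (by rw [ker_pow_zero]; trivial)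
        (by rw [ker_pow_zero]; trivial)
    have := mul_mem_kerFiltration_succ hf hg h1 hx
    rwa [one_mul] at this
  | succ k ih =>
    rw [Submodule.pow_succ] at hx
    induction hx using Submodule.mul_induction_on' with
    | mem_mul_mem x hx y hy => exact mul_mem_kerFiltration_succ hf hg (ih hx) hy
    | add x _ y _ hx hy => exact add_mem hx hy

/-- The `(m + n + 1)`-st power of the kernel of `f ⊗ g` is killed by `ρ_m ⊗ ρ_n`. -/
lemma rho_tensor_rho_eq_zero (hf : Function.Surjective f) (hg : Function.Surjective g) (m n : ℕ)
    {x : A₁.tensor A₂} (hx : x ∈ (f.tensor g).ker ^ (m + n + 1)) :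
    (f.rho m).tensor (g.rho n) x = 0 := by
  refine (Submodule.span_le (p := LinearMap.ker ((f.rho m).tensor (g.rho n)).toAlgHom.toLinearMap)).2
    ?_ (ker_tensor_pow_le hf hg _ hx)
  rintro _ ⟨i, j, hij, a, ha, b, hb, rfl⟩
  change (f.rho m).tensor (g.rho n) (tmul a b) = 0
  rw [Hom.tensor_tmul]
  -- If both `i ≤ m` and `j ≤ n`, the total exponent would be at most `m + n`.
  rcases (by omega : m + 1 ≤ i ∨ n + 1 ≤ j) with h | h
  · rw [(rho_eq_zero_iff f m a).2 (ker_pow_antitone f h ha), tmul_zero_left]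
  · rw [(rho_eq_zero_iff g n b).2 (ker_pow_antitone g h hb), tmul_zero_right]

end KernelPowers

/-! ### The product inequalities -/

section Product

variable {A₁ A₂ B₁ B₂ : CDGA.{u}} {f : Hom A₁ B₁} {g : Hom A₂ B₂}

/-- If neither term is `∞`, both minima are attained, since a nonempty set in `ℕ∞` contains its
infimum. -/
lemma smallest_le_add {P Q R : ℕ → Prop} (h : ∀ m n, P m → Q n → R (m + n)) :
    smallest R ≤ smallest P + smallest Q := by
  have mem (P : ℕ → Prop) (hP : smallest P ≠ ⊤) : ∃ m, P m ∧ smallest P = m := by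
    have hne : {N : ℕ∞ | ∃ m : ℕ, P m ∧ N = m}.Nonempty := by
      by_contra hne
      exact hP (by rw [smallest, Set.not_nonempty_iff_eq_empty.1 hne, sInf_empty])
    exact csInf_mem hne
  by_cases hP : smallest P = ⊤
  · rw [hP, top_add]; exact le_top
  by_cases hQ : smallest Q = ⊤
  · rw [hQ, add_top]; exact le_top
  obtain ⟨m, hm, em⟩ := mem P hP
  obtain ⟨n, hn, en⟩ := mem Q hQ
  rw [em, en]
  exact sInf_le ⟨m + n, h m n hm hn, by push_cast; rfl⟩

/-- The projection `ρ_m ⊗ ρ_n` factors through `ρ_{m+n}`. -/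
lemma exists_kerPowQuotient_tensor (hf : Function.Surjective f) (hg : Function.Surjective g)
    (m n : ℕ) : ∃ π : Hom ((f.tensor g).kerPowQuotient (m + n))
      ((f.kerPowQuotient m).tensor (g.kerPowQuotient n)),
        ∀ x, π ((f.tensor g).rho (m + n) x) = (f.rho m).tensor (g.rho n) x :=
  exists_rho_lift _ _ _ fun _ hx => rho_tensor_rho_eq_zero hf hg m n hx

lemma Hom.ext {A B : CDGA.{u}} {f g : Hom A B} (h : ∀ a, f a = g a) : f = g := by
  cases f
  cases g
  congr
  exact AlgHom.ext h

lemma homologyInjective_rho_add (hf : Function.Surjective f) (hg : Function.Surjective g)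
    {m n : ℕ} (hm : (f.rho m).HomologyInjective) (hn : (g.rho n).HomologyInjective) :
    ((f.tensor g).rho (m + n)).HomologyInjective := by
  obtain ⟨π, hπ⟩ := exists_kerPowQuotient_tensor hf hg m n
  refine Hom.HomologyInjective.of_comp (g := π) ?_
  rw [Hom.ext (f := π.comp _) hπ]
  exact hm.tensor hn

lemma Hom.tensor_surjective (hf : Function.Surjective f) (hg : Function.Surjective g) :
    Function.Surjective (f.tensor g) := by
  intro y
  induction y using tmul_induction with
  | add x y hx hy =>
    obtain ⟨a, rfl⟩ := hx
    obtain ⟨b, rfl⟩ := hy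
    exact ⟨a + b, map_add _ _ _⟩
  | tmul a b =>
    obtain ⟨a, rfl⟩ := hf a
    obtain ⟨b, rfl⟩ := hg b
    exact ⟨tmul a b, rfl⟩

/-- Relative Sullivan models of `ρ_m` and `ρ_n` are dominated by one of `ρ_{m+n}`. -/
lemma exists_model_rho_add (hf : Function.Surjective f) (hg : Function.Surjective g) {m n : ℕ}
    {S₁ S₂ : CDGA.{u}} {i₁ : Hom A₁ S₁} {i₂ : Hom A₂ S₂}
    (hi₁ : IsRelativeSullivanModel (f.rho m) i₁) (hi₂ : IsRelativeSullivanModel (g.rho n) i₂) :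
    ∃ (S : CDGA.{u}) (i : Hom (A₁.tensor A₂) S) (θ : Hom S (S₁.tensor S₂)),
      IsRelativeSullivanModel ((f.tensor g).rho (m + n)) i ∧ ∀ x, θ (i x) = i₁.tensor i₂ x := by
  obtain ⟨-, q₁, hq₁, hqi₁⟩ := hi₁
  obtain ⟨-, q₂, hq₂, hqi₂⟩ := hi₂
  obtain ⟨π, hπ⟩ := exists_kerPowQuotient_tensor hf hg m n
  -- Surjectivity of `q₁` is inherited from `ρ_m = q₁ ∘ i₁`; it is what allows the base change of
  -- `q₁ ⊗ q₂`.
  have hs₁ : Function.Surjective q₁ := fun y => by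
    obtain ⟨a, rfl⟩ := rho_surjective f m y
    exact ⟨_, hqi₁ a⟩
  have hs₂ : Function.Surjective q₂ := fun y => by
    obtain ⟨a, rfl⟩ := rho_surjective g n y
    exact ⟨_, hqi₂ a⟩
  have hcomm (x : A₁.tensor A₂) :
      π ((f.tensor g).rho (m + n) x) = q₁.tensor q₂ (i₁.tensor i₂ x) := by
    rw [hπ]
    induction x using tmul_induction with
    | add x y hx hy => simp only [map_add, hx, hy]
    | tmul a b => simp only [Hom.tensor_tmul, hqi₁, hqi₂]
  -- The map into the pullback is modelled, rather than `ρ_{m+n}`. The first projection, a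
  -- quasi-isomorphism, turns this into a model of `ρ_{m+n}`, and the second provides `θ` without
  -- any lifting.
  obtain ⟨S, i, hi, q, hq, hqi⟩ := exists_relativeSullivanModel
    (pullbackLift ((f.tensor g).rho (m + n)) (i₁.tensor i₂) hcomm)
  refine ⟨S, i, (pullbackSnd _ _).comp q, ⟨hi, (pullbackFst _ _).comp q,
    (pullbackFst_quasiIso (Hom.tensor_surjective hs₁ hs₂) (hq₁.tensor hq₂)).comp hq,
    fun a => ?_⟩, fun x => ?_⟩
  · rw [Hom.comp_apply, hqi]; rfl
  · rw [Hom.comp_apply, hqi]; rfl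

lemma hasHomotopyRetraction_rho_add (hf : Function.Surjective f) (hg : Function.Surjective g)
    {m n : ℕ} (hm : HasHomotopyRetraction (f.rho m)) (hn : HasHomotopyRetraction (g.rho n)) :
    HasHomotopyRetraction ((f.tensor g).rho (m + n)) := by
  obtain ⟨S₁, i₁, hi₁, r₁, hr₁⟩ := hm
  obtain ⟨S₂, i₂, hi₂, r₂, hr₂⟩ := hn
  obtain ⟨S, i, θ, hi, hθ⟩ := exists_model_rho_add hf hg hi₁ hi₂
  refine ⟨S, i, hi, (r₁.tensor r₂).comp θ, fun x => ?_⟩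
  rw [Hom.comp_apply, hθ]
  induction x using tmul_induction with
  | add x y hx hy => simp only [map_add, hx, hy]
  | tmul a b => rw [Hom.tensor_tmul, Hom.tensor_tmul, hr₁, hr₂]

/-- The tensor product of two morphisms of modules. -/
noncomputable def ModuleHom.tensor {S₁ S₂ : CDGA.{u}} {i₁ : Hom A₁ S₁} {i₂ : Hom A₂ S₂}
    (r₁ : ModuleHom i₁) (r₂ : ModuleHom i₂) : ModuleHom (i₁.tensor i₂) where
  toLinearMap := tmap r₁.toLinearMap r₂.toLinearMap
  map_gr {n s} hs := by
    refine (Submodule.span_le (p := ((A₁.tensor A₂).gr n).comap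
      (tmap r₁.toLinearMap r₂.toLinearMap))).2 ?_ hs
    rintro _ ⟨i, j, rfl, a, ha, b, hb, rfl⟩
    exact tmul_mem (r₁.map_gr ha) (r₂.map_gr hb)
  map_d := tmap_d r₁.map_d (fun x => by
    induction x using homogeneous_induction with
    | add x y hx hy => simp only [map_add, hx, hy]
    | hom i a ha =>
      rw [signMap_of_mem ha, signMap_of_mem (r₁.map_gr ha)]
      exact map_units_smul r₁.toLinearMap.toAddMonoidHom _ _) r₂.map_d
  map_act x y := by
    induction x using tensor_induction with
    | add x x' hx hx' =>
      exact (congrArg _ ((congrArg (· * y) (map_add (i₁.tensor i₂).toAlgHom x x')).trans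
        (add_mul _ _ _))).trans ((map_add _ _ _).trans
          ((congrArg₂ _ hx hx').trans (add_mul (R := A₁.tensor A₂) x x' _).symm))
    | tmul i j a b ha hb =>
      induction y using tensor_induction with
      | add y y' hy hy' =>
        exact (congrArg _ (mul_add (R := S₁.tensor S₂) _ y y')).trans
          ((map_add _ _ _).trans ((congrArg₂ _ hy hy').trans
            ((mul_add _ _ _).symm.trans (congrArg _ (map_add _ _ _).symm))))
      | tmul k l s t hs ht =>
        have hu := map_units_smul (tmap r₁.toLinearMap r₂.toLinearMap).toAddMonoidHom
        simp only [LinearMap.toAddMonoidHom_coe] at hu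
        change tmap r₁.toLinearMap r₂.toLinearMap (i₁.tensor i₂ (tmul a b) * tmul s t) =
          tmul a b * tmap r₁.toLinearMap r₂.toLinearMap (tmul s t)
        -- As `r₁` has degree `0`, moving `b` past `s` and past its image under `r₁` costs the same
        -- sign.
        rw [Hom.tensor_tmul, tmul_mul_tmul _ _ (i₂.map_gr hb) hs, hu, tmap_tmul, tmap_tmul,
          tmul_mul_tmul _ _ hb (r₁.map_gr hs), r₁.map_act, r₂.map_act]

lemma hasModuleHomotopyRetraction_rho_add (hf : Function.Surjective f)
    (hg : Function.Surjective g) {m n : ℕ} (hm : HasModuleHomotopyRetraction (f.rho m))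
    (hn : HasModuleHomotopyRetraction (g.rho n)) :
    HasModuleHomotopyRetraction ((f.tensor g).rho (m + n)) := by
  obtain ⟨S₁, i₁, hi₁, r₁, hr₁⟩ := hm
  obtain ⟨S₂, i₂, hi₂, r₂, hr₂⟩ := hn
  obtain ⟨S, i, θ, hi, hθ⟩ := exists_model_rho_add hf hg hi₁ hi₂
  have hr (x : A₁.tensor A₂) : (r₁.tensor r₂).toLinearMap (i₁.tensor i₂ x) = x := by
    induction x using tmul_induction with
    | add x y hx hy => rw [map_add, map_add, hx, hy]
    | tmul a b =>
      rw [Hom.tensor_tmul]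
      exact congrArg₂ tmul (hr₁ a) (hr₂ b)
  refine ⟨S, i, hi,
    { toLinearMap := (r₁.tensor r₂).toLinearMap ∘ₗ θ.toAlgHom.toLinearMap
      map_gr := fun h => (r₁.tensor r₂).map_gr (θ.map_gr h)
      map_d := fun s => ?_
      map_act := fun a s => ?_ }, fun x => ?_⟩
  · exact (congrArg _ (θ.map_d s)).trans ((r₁.tensor r₂).map_d _)
  -- Because `θ ∘ i = i₁ ⊗ i₂`, the algebra morphism `θ` is linear over `A₁ ⊗ A₂`.
  · refine (congrArg _ (map_mul θ.toAlgHom (i a) s)).trans ?_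
    rw [hθ]
    exact (r₁.tensor r₂).map_act a (θ s)
  · exact (congrArg _ (hθ x)).trans (hr x)

end Product

end CDGA

theorem mainTheorem4 {A₁ B₁ A₂ B₂ : CDGA.{u}} (φ₁ : CDGA.Hom A₁ B₁) (φ₂ : CDGA.Hom A₂ B₂)
    (h₁ : Function.Surjective φ₁) (h₂ : Function.Surjective φ₂) :
    CDGA.asecat (φ₁.tensor φ₂) ≤ CDGA.asecat φ₁ + CDGA.asecat φ₂ ∧
    CDGA.amsecat (φ₁.tensor φ₂) ≤ CDGA.amsecat φ₁ + CDGA.amsecat φ₂ ∧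
    CDGA.ahsecat (φ₁.tensor φ₂) ≤ CDGA.ahsecat φ₁ + CDGA.ahsecat φ₂ :=
  ⟨CDGA.smallest_le_add fun _ _ => CDGA.hasHomotopyRetraction_rho_add h₁ h₂,
    CDGA.smallest_le_add fun _ _ => CDGA.hasModuleHomotopyRetraction_rho_add h₁ h₂,
    CDGA.smallest_le_add fun _ _ => CDGA.homologyInjective_rho_add h₁ h₂⟩
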